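/- Let $m\ge 3$, let $\mathcal F=\mathbb Q(x_1,\dots,x_m)$, and let $\Sigma=(\tilde{\mathbf x},\tilde B)$ be a seed of rank $3$ in $\mathcal F$: $\tilde{\mathbf x}$ is an $m$-tuple of elements that freely generates the field $\mathcal F$ over $\mathbb Q$, and $\tilde B=(b_{ij})$ is an integer $m\times 3$ matrix. Assume that the principal part $B$ of $\tilde B$ (its top three rows) is skew-symmetric. Mutation of a seed at $k\in\{1,2,3\}$ replaces $x_k$ by $x_k^{-1}\big(\prod_i x_i^{[b_{ik}]_+}+\prod_i x_i^{[-b_{ik}]_+}\big)$, keeps the other $x_i$, and replaces $b_{ij}$ by $-b_{ij}$ if $i=k$ or $j=k$ and by $b_{ij}+\frac{|b_{ik}|b_{kj}+b_{ik}|b_{kj}|}2$ otherwise, where $[b]_+=\max(0,b)$. Put $\mathbb{ZP}=\mathbb Z[x_4^{\pm1},\dots,x_m^{\pm1}]$. Let $\mathcal A\subset\mathcal F$ be the cluster algebra of $\Sigma$, i.e. the subring generated over $\mathbb{ZP}$ by the elements $x_1',x_2',x_3'$ of all seeds $(\tilde{\mathbf x}',\tilde B')$ obtained from $\Sigma$ by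 sequences of mutations, and let $\mathcal U$ be the upper cluster algebra, i.e. the intersection of the rings $\mathbb{ZP}[x_1'^{\pm1},x_2'^{\pm1},x_3'^{\pm1}]$ over all these seeds. Assume that $\mathcal A$ is non-acyclic: for each of these seeds, the digraph on $\{1,2,3\}$ with an arrow $i\to j$ whenever $b'_{ij}>0$ has an oriented cycle. Then $$\mathcal A\subsetneq\mathcal U .$$ Moreover, an explicit witness is as follows. For a seed with extended cluster $\tilde{\mathbf x}$ and matrix $\tilde B$, put $b_{ij}=-b_{ji}$ for $i\le 3<j\le m$ and $b_{ij}=0$ for $i,j>3$, and for $\mathbf a\in\{0,1\}^3$ let $$\tilde x[\mathbf a]=\Big(\prod_{l=1}^3x_l^{-a_l}\Big)\sum_{\mathbf s}\ \prod_{\substack{1\le i,j\le m\\ b_{ij}>0}}x_i^{b_{ij}(a_j-s_j)}x_j^{-b_{ji}s_i},$$ where $\mathbf s$ runs over all $\mathbf s\in\{0,1\}^3$ such that $s_i\le a_i$ for all $i$ and $s_i(a_j-s_j)=0$ whenever $i,j\le 3$ and $b_{ij}>0$; here $a_i=s_i=0$ for $i>3$. Then there are a seed obtained from $\Sigma$ by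 mutations and an enumeration $(i,j,k)$ of $\{1,2,3\}$ such that the numbers $a=|b_{ij}|$, $b=|b_{jk}|$, $c=|b_{ki}|$ of this seed satisfy $$a\ge b\ge c,\qquad a\le bc-a,\quad b\le ac-b,\quad c\le ab-c, \tag{$*$}$$ and for every such seed and every enumeration with $(*)$ the element $Y=\tilde x[\mathbf e_i+\mathbf e_k]/x_j^{\,b}$ (which is $\tilde x[(1,0,1)]/x_2^{\,b}$ when $(i,j,k)=(1,2,3)$) satisfies $Y\in\mathcal U$ and $Y\notin\mathcal A$. -/

import Mathlib

namespace GeomCluster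

/-- The data `(x̃, B̃)` of a seed of rank `n` with `p` frozen variables: an extended cluster in the
field `F` and an integer matrix with rows `1, …, n + p` and columns `1, …, n`.  The index `inl i`
stands for the mutable index `i`, the index `inr j` for the frozen index `n + j`. -/
structure SeedData (n p : ℕ) (F : Type*) where
  x : Fin n ⊕ Fin p → F
  B : Matrix (Fin n ⊕ Fin p) (Fin n) ℤ

namespace SeedData

variable {n p : ℕ} {F : Type*}

/-- The principal part: the top `n` rows of the extended exchange matrix. -/
def principal (S : SeedData n p F) : Fin n → Fin n → ℤ :=
  fun i j => S.B (Sum.inl i) j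

/-- The principal part is sign-skew-symmetric (for `i = j` this says `b i i = 0`). -/
def SignSkewSymmetric (S : SeedData n p F) : Prop :=
  ∀ i j, (S.principal i j = 0 ∧ S.principal j i = 0) ∨ S.principal i j * S.principal j i < 0

/-- The principal part is skew-symmetric. -/
def SkewSymmetric (S : SeedData n p F) : Prop :=
  ∀ i j, S.principal i j = -S.principal j i

/-- The principal part is acyclic: the digraph with an arrow `i → j` for `b i j > 0` has no
oriented cycle. -/
def IsAcyclic (S : SeedData n p F) : Prop :=
  ∀ i, ¬ Relation.TransGen (fun i j : Fin n => 0 < S.principal i j) i i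

section Field

variable [Field F]

/-- `(x̃, B̃)` is a seed in `F`: the extended cluster is a free generating set of the field `F`
over `ℚ`, and the principal part is sign-skew-symmetric. -/
def IsSeed [Algebra ℚ F] (S : SeedData n p F) : Prop :=
  AlgebraicIndependent ℚ S.x ∧ IntermediateField.adjoin ℚ (Set.range S.x) = ⊤ ∧
    S.SignSkewSymmetric

/-- Mutation at `k`.  The positive part `[b]₊` of an integer is `b.toNat`, and the division by `2`
is exact. -/
def mutate (S : SeedData n p F) (k : Fin n) : SeedData n p F where
  x := Function.update S.x (Sum.inl k)
    ((S.x (Sum.inl k))⁻¹ *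
      (∏ i, S.x i ^ (S.B i k).toNat + ∏ i, S.x i ^ (-S.B i k).toNat))
  B := fun i j =>
    if i = Sum.inl k ∨ j = k then -S.B i j
    else S.B i j + (|S.B i k| * S.B (Sum.inl k) j + S.B i k * |S.B (Sum.inl k) j|) / 2

/-- `T` is obtained from `S` by one well-defined mutation. -/
def Mutates (S T : SeedData n p F) : Prop :=
  ∃ k, T = S.mutate k ∧ T.SignSkewSymmetric

/-- `T` is obtained from `S` by a finite sequence of well-defined mutations. -/
def MutationEquiv (S T : SeedData n p F) : Prop :=
  Relation.ReflTransGen Mutates S T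

/-- The ground ring `ℤℙ = ℤ[xₙ₊₁^±1, …, xₙ₊ₚ^±1]`.  Mutations do not change it. -/
def groundRing (S : SeedData n p F) : Subring F :=
  Subring.closure {y | ∃ j, y = S.x (Sum.inr j) ∨ y = (S.x (Sum.inr j))⁻¹}

/-- The cluster algebra with initial seed `S`: generated over `ℤℙ` by the cluster variables of all
seeds that are mutation-equivalent to `S`. -/
def clusterAlgebra (S : SeedData n p F) : Subring F :=
  Subring.closure ((S.groundRing : Set F) ∪
    {y | ∃ T, S.MutationEquiv T ∧ ∃ i, y = T.x (Sum.inl i)})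

/-- The Laurent polynomial ring `R[x₁^±1, …, xₙ^±1]` in the cluster of `T`, inside `F`. -/
def laurentRing (R : Subring F) (T : SeedData n p F) : Subring F :=
  Subring.closure ((R : Set F) ∪
    {y | ∃ i, y = T.x (Sum.inl i) ∨ y = (T.x (Sum.inl i))⁻¹})

/-- The upper cluster algebra: the intersection of the Laurent polynomial rings over `ℤℙ` in all
clusters of the cluster algebra with initial seed `S`. -/
def upperClusterAlgebra (S : SeedData n p F) : Subring F :=
  ⨅ T : {T : SeedData n p F // S.MutationEquiv T}, laurentRing S.groundRing T.1

/-- The cluster algebra with initial seed `S` is non-acyclic: it has no acyclic seed. -/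
def NonAcyclic (S : SeedData n p F) : Prop :=
  ∀ T, S.MutationEquiv T → ¬ T.IsAcyclic

end Field

/-- The matrix `b i j` for all `i, j ∈ {1, …, n + p}`: `b i j = -b j i` if `i` is mutable and `j`
is frozen, and `b i j = 0` if both are frozen. -/
def extB (S : SeedData n p F) : Fin n ⊕ Fin p → Fin n ⊕ Fin p → ℤ
  | i, Sum.inl j => S.B i j
  | Sum.inl i, Sum.inr j => -S.B (Sum.inr j) i
  | Sum.inr _, Sum.inr _ => 0

end SeedData

/-- The complement `t̄ = (1 - t₁, …, 1 - tₐ)` of a `{0,1}`-sequence. -/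
def seqCompl {a : ℕ} (t : Fin a → Fin 2) : Fin a → Fin 2 :=
  fun r => 1 - t r

/-- The sum `|t|` of a `{0,1}`-sequence. -/
def seqSum {a : ℕ} (t : Fin a → Fin 2) : ℕ :=
  ∑ r, (t r : ℕ)

/-- The product `t · t' = ∑ tᵣ t'ᵣ` over `r ≤ min(a, b)` of two `{0,1}`-sequences. -/
def seqDot {a b : ℕ} (t : Fin a → Fin 2) (t' : Fin b → Fin 2) : ℕ :=
  ∑ r : Fin (min a b),
    (t (Fin.castLE (Nat.min_le_left a b) r) : ℕ) * (t' (Fin.castLE (Nat.min_le_right a b) r) : ℕ)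

/-- The families `s = (s₁, …, sₙ)` of `{0,1}`-sequences, `sᵢ` of length `[aᵢ]₊`. -/
abbrev SeqFamily {n : ℕ} (a : Fin n → ℤ) : Type :=
  (i : Fin n) → Fin (a i).toNat → Fin 2

namespace SeedData

variable {n p : ℕ} {F : Type*}

/-- The families `s` with `sᵢ · s̄ⱼ = 0` whenever `b i j > 0`, `i, j ≤ n`. -/
def gcc (S : SeedData n p F) (a : Fin n → ℤ) : Finset (SeqFamily a) :=
  Finset.univ.filter fun s =>
    ∀ i j, 0 < S.principal i j → seqDot (s i) (seqCompl (s j)) = 0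

variable [Field F]

/-- The element `x̃[a] = (∏ xₗ^(-aₗ)) ∑ₛ ∏ xᵢ^(bᵢⱼ |s̄ⱼ|) xⱼ^(-bⱼᵢ |sᵢ|)`; `s` runs over `S.gcc a`
and the inner product over all pairs `(i, j)`, `1 ≤ i, j ≤ n + p`, with `bᵢⱼ > 0`; the sequences
`sᵢ` with `i` frozen are empty. -/
def xTilde (S : SeedData n p F) (a : Fin n → ℤ) : F :=
  (∏ l, S.x (Sum.inl l) ^ (-a l)) *
    ∑ s ∈ S.gcc a,
      ∏ q : (Fin n ⊕ Fin p) × (Fin n ⊕ Fin p) with 0 < S.extB q.1 q.2,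
        S.x q.1 ^ (S.extB q.1 q.2 * Sum.elim (fun j => (seqSum (seqCompl (s j)) : ℤ)) 0 q.2) *
          S.x q.2 ^ (-S.extB q.2 q.1 * Sum.elim (fun i => (seqSum (s i) : ℤ)) 0 q.1)

/-- For a seed of rank 3 and an enumeration `(i, j, k) = (σ 0, σ 1, σ 2)` of the mutable indices
put `a = |b i j|`, `b = |b j k|`, `c = |b k i|`.  The condition says that `a ≥ b ≥ c` and that none
of the three maps `a ↦ bc - a`, `b ↦ ac - b`, `c ↦ ab - c` decreases its entry. -/
def IsRoot (T : SeedData 3 p F) (σ : Equiv.Perm (Fin 3)) : Prop :=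
  let a := |T.principal (σ 0) (σ 1)|
  let b := |T.principal (σ 1) (σ 2)|
  let c := |T.principal (σ 2) (σ 0)|
  c ≤ b ∧ b ≤ a ∧ a ≤ b * c - a ∧ b ≤ a * c - b ∧ c ≤ a * b - c

/-- With the same notation, the element `Y = x̃[eᵢ + eₖ] / xⱼ^b`; for the identical enumeration it
is `x̃[(1, 0, 1)] / x₂^b`. -/
def witness (T : SeedData 3 p F) (σ : Equiv.Perm (Fin 3)) : F :=
  T.xTilde (Pi.single (σ 0) 1 + Pi.single (σ 2) 1) /
    T.x (Sum.inl (σ 1)) ^ |T.principal (σ 1) (σ 2)|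

end SeedData

end GeomCluster

namespace GeomCluster

open Polynomial

/-! ### Exchange rings `K[x, P/x]` inside a field. -/

section Exchange

variable {F : Type*} [Field F]

/-! In rank 3 a non-acyclic quiver is a cyclically oriented triangle, and this holds at every seed.
Two consequences drive the proof.

First, no off-diagonal entry of the principal part ever vanishes. For such seeds the upper bound
(the intersection of the Laurent rings of a cluster and of its three neighbours) is invariant under
mutation, without any coprimality assumption. The point is that `K[x, x⁻¹] ∩ K[P/x, x/P] = K[x,
P/x]`, and that a mutation at `k` changes the exchange polynomial at `j` only by a power of some `1
+ w` with `w` divisible by `x_j`; such a factor is 1 modulo `x_j` and can be cancelled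
(`mem_exchangeRing_mutate`). Hence the upper bound of any seed lies in the upper cluster algebra and
contains the cluster algebra, and membership of `Y` need only be tested at the seed that defines it
and its neighbours.

Second, giving `x_l` the degree `|b|` of the opposite edge, and frozen variables degree 0, defines a
grading independent of the seed: both monomials of each exchange relation have the same degree, and
the new degree is the product of the other two minus the old one. A seed of minimal total degree
satisfies the root inequalities. Along reduced mutation sequences starting at a root, every new
variable except possibly `x_k'` has degree at least `ac - b`, the degree of `x_i'`
(`ReducedFrom.deg_le`). The witness `Y` is homogeneous of the smaller degree `ac - a - b`.

So if `Y` were in the cluster algebra, it would be a polynomial over the ground ring in `x_i, x_j,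
x_k, x_k'`, all of which are polynomial in `x_i` with coefficients Laurent in the remaining
variables. But `Y x_k` is a frozen monomial times `x_i'` plus a term polynomial in `x_i`, while
`x_i'` has a genuine pole along `x_i = 0`. -/

theorem ne_zero_of_transcendental {K : Subring F} {x : F} (hx : Transcendental K x) : x ≠ 0 := by
  rintro rfl
  exact hx isAlgebraic_zero

/-- The ring `K[x, x⁻¹]` inside a field. -/
def laurentAdjoin (K : Subring F) (x : F) : Subring F :=
  Subring.closure ((K : Set F) ∪ {x, x⁻¹})

/-- The ring `K[x, P / x]` inside a field. -/
def exchangeRing (K : Subring F) (x P : F) : Subring F :=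
  Subring.closure ((K : Set F) ∪ {x, P / x})

theorem le_laurentAdjoin (K : Subring F) (x : F) : K ≤ laurentAdjoin K x :=
  fun _ h => Subring.subset_closure (Or.inl h)

theorem self_mem_laurentAdjoin (K : Subring F) (x : F) : x ∈ laurentAdjoin K x :=
  Subring.subset_closure (by simp)

theorem inv_mem_laurentAdjoin (K : Subring F) (x : F) : x⁻¹ ∈ laurentAdjoin K x :=
  Subring.subset_closure (by simp)

theorem laurentAdjoin_le {K L : Subring F} {x : F} (h : K ≤ L) (hx : x ∈ L) (hx' : x⁻¹ ∈ L) :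
    laurentAdjoin K x ≤ L := by
  refine Subring.closure_le.2 ?_
  rintro y (hy | rfl | rfl)
  exacts [h hy, hx, hx']

theorem le_exchangeRing (K : Subring F) (x P : F) : K ≤ exchangeRing K x P :=
  fun _ h => Subring.subset_closure (Or.inl h)

theorem self_mem_exchangeRing (K : Subring F) (x P : F) : x ∈ exchangeRing K x P :=
  Subring.subset_closure (by simp)

theorem div_mem_exchangeRing (K : Subring F) (x P : F) : P / x ∈ exchangeRing K x P :=
  Subring.subset_closure (by simp)

theorem exchangeRing_le {K L : Subring F} {x P : F} (h : K ≤ L) (hx : x ∈ L) (hx' : P / x ∈ L) :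
    exchangeRing K x P ≤ L := by
  refine Subring.closure_le.2 ?_
  rintro y (hy | rfl | rfl)
  exacts [h hy, hx, hx']

theorem exists_polynomial_of_mem_laurentAdjoin {K : Subring F} {x f : F} (hx : x ≠ 0)
    (hf : f ∈ laurentAdjoin K x) : ∃ (N : ℕ) (q : K[X]), x ^ N * f = aeval x q := by
  induction hf using Subring.closure_induction with
  | mem y hy =>
    rcases hy with hy | rfl | rfl
    · exact ⟨0, C ⟨y, hy⟩, by simp; rfl⟩
    · exact ⟨0, X, by simp⟩
    · exact ⟨1, 1, by simp [hx]⟩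
  | zero => exact ⟨0, 0, by simp⟩
  | one => exact ⟨0, 1, by simp⟩
  | add y z _ _ hy hz =>
    obtain ⟨N, q, hq⟩ := hy
    obtain ⟨M, r, hr⟩ := hz
    refine ⟨N + M, X ^ M * q + X ^ N * r, ?_⟩
    simp only [map_add, map_mul, map_pow, aeval_X, ← hq, ← hr]
    ring
  | neg y _ hy =>
    obtain ⟨N, q, hq⟩ := hy
    exact ⟨N, -q, by simp [← hq]⟩
  | mul y z _ _ hy hz =>
    obtain ⟨N, q, hq⟩ := hy
    obtain ⟨M, r, hr⟩ := hz
    refine ⟨N + M, q * r, ?_⟩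
    simp only [map_mul, ← hq, ← hr]
    ring

/-- The coefficient of `x ^ (-m)` must be divisible by `P ^ m`: this holds for the generators and
survives products because the exponents add. With the next two lemmas this becomes a coefficientwise
membership test. -/
theorem exists_polynomial_of_mem_exchangeRing {K : Subring F} {x f : F} {P : K} (hx : x ≠ 0)
    (hf : f ∈ exchangeRing K x P) :
    ∃ (N : ℕ) (q : K[X]), x ^ N * f = aeval x q ∧ ∀ i, P ^ (N - i) ∣ q.coeff i := by
  induction hf using Subring.closure_induction with
  | mem y hy =>
    rcases hy with hy | rfl | rfl
    · exact ⟨0, C ⟨y, hy⟩, by simp; rfl, by simp⟩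
    · exact ⟨0, X, by simp, by simp⟩
    · refine ⟨1, C P, ?_, fun i => ?_⟩
      · simp only [pow_one, aeval_C]
        exact mul_div_cancel₀ _ hx
      · rcases i with _ | i <;> simp
  | zero => exact ⟨0, 0, by simp, by simp⟩
  | one => exact ⟨0, 1, by simp, by simp⟩
  | add y z _ _ hy hz =>
    obtain ⟨N, q, hq, hq'⟩ := hy
    obtain ⟨M, r, hr, hr'⟩ := hz
    refine ⟨N + M, X ^ M * q + X ^ N * r, ?_, fun i => ?_⟩
    · simp only [map_add, map_mul, map_pow, aeval_X, ← hq, ← hr]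
      ring
    · simp only [coeff_add, coeff_X_pow_mul']
      refine dvd_add ?_ ?_
      · split_ifs with h
        · exact (pow_dvd_pow _ (by omega)).trans (hq' _)
        · exact dvd_zero _
      · split_ifs with h
        · exact (pow_dvd_pow _ (by omega)).trans (hr' _)
        · exact dvd_zero _
  | neg y _ hy =>
    obtain ⟨N, q, hq, hq'⟩ := hy
    exact ⟨N, -q, by simp [← hq], fun i => by simpa using hq' i⟩
  | mul y z _ _ hy hz =>
    obtain ⟨N, q, hq, hq'⟩ := hy
    obtain ⟨M, r, hr, hr'⟩ := hz
    refine ⟨N + M, q * r, ?_, fun i => ?_⟩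
    · simp only [map_mul, ← hq, ← hr]
      ring
    · rw [coeff_mul]
      refine Finset.dvd_sum fun s hs => ?_
      rw [Finset.HasAntidiagonal.mem_antidiagonal] at hs
      refine Dvd.dvd.trans ?_ (mul_dvd_mul (hq' s.1) (hr' s.2))
      rw [← pow_add]
      exact pow_dvd_pow _ (by omega)

theorem mem_exchangeRing_of_polynomial {K : Subring F} {x f : F} {P : K} (hx : x ≠ 0) {N : ℕ}
    {q : K[X]} (hq : x ^ N * f = aeval x q) (h : ∀ i, P ^ (N - i) ∣ q.coeff i) :
    f ∈ exchangeRing K x P := by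
  have hf : f = ∑ i ∈ Finset.range (q.natDegree + 1), (q.coeff i : F) * x ^ i / x ^ N := by
    rw [← Finset.sum_div, eq_div_iff (pow_ne_zero _ hx), mul_comm, hq, aeval_eq_sum_range]
    rfl
  rw [hf]
  refine Subring.sum_mem _ fun i _ => ?_
  rcases le_total N i with hi | hi
  · obtain ⟨e, rfl⟩ := Nat.exists_eq_add_of_le hi
    have : (q.coeff (N + e) : F) * x ^ (N + e) / x ^ N = (q.coeff (N + e) : F) * x ^ e := by
      field_simp
      ring
    rw [this]
    exact Subring.mul_mem _ (le_exchangeRing _ _ _ (q.coeff _).2)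
      (Subring.pow_mem _ (self_mem_exchangeRing _ _ _) _)
  · obtain ⟨e, rfl⟩ := Nat.exists_eq_add_of_le hi
    obtain ⟨r, hr⟩ := h i
    have : (q.coeff i : F) * x ^ i / x ^ (i + e) = (r : F) * ((P : F) / x) ^ e := by
      rw [hr, Nat.add_sub_cancel_left, div_pow]
      push_cast
      field_simp
      ring
    rw [this]
    exact Subring.mul_mem _ (le_exchangeRing _ _ _ r.2)
      (Subring.pow_mem _ (div_mem_exchangeRing _ _ _) _)

/-- Transcendence of `x` makes the expansion unique, so the divisibility holds for every way of
writing `f` as a polynomial over a power of `x`. -/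
theorem dvd_coeff_of_mem_exchangeRing {K : Subring F} {x f : F} {P : K} (hx : Transcendental K x)
    (hf : f ∈ exchangeRing K x P) {N : ℕ} {q : K[X]} (hq : x ^ N * f = aeval x q) (i : ℕ) :
    P ^ (N - i) ∣ q.coeff i := by
  obtain ⟨M, r, hr, hr'⟩ := exists_polynomial_of_mem_exchangeRing (ne_zero_of_transcendental hx) hf
  have e : X ^ M * q = X ^ N * r := by
    refine transcendental_iff_injective.1 hx ?_
    simp only [map_mul, map_pow, aeval_X, ← hq, ← hr]
    ring
  have := congrArg (fun s => coeff s (i + M)) e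
  simp only [mul_comm (X ^ M), coeff_mul_X_pow] at this
  rw [this, coeff_X_pow_mul']
  split_ifs with h
  · exact (pow_dvd_pow _ (by omega)).trans (hr' _)
  · exact dvd_zero _

/-- A Laurent polynomial both in `x` and in `P / x` lies in `K[x, P / x]`. -/
theorem laurentAdjoin_inf_le_exchangeRing {K : Subring F} {x : F} {P : K}
    (hx : Transcendental K x) (hP : P ≠ 0) :
    laurentAdjoin K x ⊓ laurentAdjoin K (P / x) ≤ exchangeRing K x P := by
  rintro f ⟨hf, hf'⟩
  have hx0 := (ne_zero_of_transcendental hx)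
  have hP0 : (P : F) ≠ 0 := fun h => hP (Subtype.ext h)
  obtain ⟨N, p, hp⟩ := exists_polynomial_of_mem_laurentAdjoin hx0 hf
  obtain ⟨M, q, hq⟩ := exists_polynomial_of_mem_laurentAdjoin (div_ne_zero hP0 hx0) hf'
  refine mem_exchangeRing_of_polynomial hx0 hp fun l => ?_
  -- The two expansions of `P ^ M * f`, both multiplied by `x ^ (N + deg q)` to remove negative
  -- powers. For `l < N`, comparing coefficients leaves only `i = N + M - l` on the right, which
  -- carries the factor `P ^ M * P ^ (N - l)`.
  have e : C (P ^ M) * (X ^ q.natDegree * p) = ∑ i ∈ Finset.range (q.natDegree + 1),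
      C (q.coeff i * P ^ i) * X ^ (N + M + (q.natDegree - i)) := by
    refine transcendental_iff_injective.1 hx ?_
    have h1 : (P : F) ^ M * f = x ^ M * aeval ((P : F) / x) q := by
      rw [← hq, div_pow]
      field_simp
    simp only [map_mul, map_pow, aeval_X, map_sum, aeval_C]
    rw [← hp]
    calc _ = (x ^ N * x ^ q.natDegree) * ((P : F) ^ M * f) := by
          change (P : F) ^ M * _ = _
          ring
      _ = _ := by
        rw [h1, aeval_eq_sum_range, Finset.mul_sum, Finset.mul_sum]
        refine Finset.sum_congr rfl fun i hi => ?_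
        rw [Finset.mem_range] at hi
        obtain ⟨e, he⟩ := Nat.exists_eq_add_of_le (Nat.lt_succ_iff.1 hi)
        rw [he, Nat.add_sub_cancel_left]
        change _ * (_ * ((q.coeff i : F) * _)) = (q.coeff i : F) * (P : F) ^ i * _
        rw [div_pow]
        field_simp
        ring
  by_cases hl : N ≤ l
  · simp [Nat.sub_eq_zero_of_le hl]
  have := congrArg (fun s => coeff s (l + q.natDegree)) e
  simp only [coeff_C_mul, mul_comm (X ^ q.natDegree), coeff_mul_X_pow, finsetSum_coeff,
    coeff_X_pow] at this
  have hd : P ^ M * P ^ (N - l) ∣ P ^ M * p.coeff l := by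
    rw [this]
    refine Finset.dvd_sum fun i hi => ?_
    rw [Finset.mem_range] at hi
    split_ifs with h
    · rw [mul_one, ← pow_add]
      exact Dvd.dvd.mul_left (pow_dvd_pow _ (by omega)) _
    · simp
  exact (mul_dvd_mul_iff_left (pow_ne_zero _ hP)).1 hd

/-- Denominators with invertible constant term can be cleared in `K[x, P / x]`. -/
theorem mem_exchangeRing_of_mul_mem {K : Subring F} {x f : F} {P : K} (hx : Transcendental K x)
    (hf : f ∈ laurentAdjoin K x) {Q : K[X]} (hQ : IsUnit (Q.coeff 0))
    (h : aeval x Q * f ∈ exchangeRing K x P) : f ∈ exchangeRing K x P := by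
  obtain ⟨N, p, hp⟩ := exists_polynomial_of_mem_laurentAdjoin (ne_zero_of_transcendental hx) hf
  refine mem_exchangeRing_of_polynomial (ne_zero_of_transcendental hx) hp fun l => ?_
  -- In `(Q * p).coeff l` every term except `Q.coeff 0 * p.coeff l` involves an earlier coefficient
  -- of `p`, which is divisible by an even higher power of `P`.
  induction l using Nat.strong_induction_on with
  | _ l ih =>
    have h1 : P ^ (N - l) ∣ (Q * p).coeff l := by
      refine dvd_coeff_of_mem_exchangeRing hx h ?_ l
      rw [map_mul, ← hp]
      ring
    rw [coeff_mul, Finset.Nat.sum_antidiagonal_eq_sum_range_succ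
      (fun i j => Q.coeff i * p.coeff j), Finset.sum_range_succ'] at h1
    rw [Nat.sub_zero] at h1
    have h2 := (dvd_add_right (Finset.dvd_sum fun i hi => ?_)).1 h1
    · exact (hQ.dvd_mul_left).1 h2
    · rw [Finset.mem_range] at hi
      exact Dvd.dvd.mul_left ((pow_dvd_pow _ (by omega)).trans (ih _ (by omega))) _

/-- The elements that some power of `q` multiplies into `E`. -/
def denomSubring (E : Subring F) (q : F) (hq : q ∈ E) : Subring F where
  carrier := {f | ∃ n : ℕ, q ^ n * f ∈ E}
  zero_mem' := ⟨0, by simp⟩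
  one_mem' := ⟨0, by simp⟩
  add_mem' := by
    rintro f g ⟨n, hn⟩ ⟨m, hm⟩
    refine ⟨n + m, ?_⟩
    have : q ^ (n + m) * (f + g) = q ^ m * (q ^ n * f) + q ^ n * (q ^ m * g) := by ring
    rw [this]
    exact E.add_mem (E.mul_mem (E.pow_mem hq _) hn) (E.mul_mem (E.pow_mem hq _) hm)
  neg_mem' := by
    rintro f ⟨n, hn⟩
    exact ⟨n, by simpa using hn⟩
  mul_mem' := by
    rintro f g ⟨n, hn⟩ ⟨m, hm⟩
    refine ⟨n + m, ?_⟩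
    have : q ^ (n + m) * (f * g) = (q ^ n * f) * (q ^ m * g) := by ring
    rw [this]
    exact E.mul_mem hn hm

end Exchange

/-! ### Laurent rings in subsets of a cluster. -/

section Laurent

variable {F ι : Type*} [Field F]

/-- The Laurent polynomial ring over `ℤ` in the elements `x i`, `i ∈ t`, of a field. -/
def laurentSubring (x : ι → F) (t : Set ι) : Subring F :=
  Subring.closure {y | ∃ i ∈ t, y = x i ∨ y = (x i)⁻¹}

theorem laurentSubring_mono (x : ι → F) {s t : Set ι} (h : s ⊆ t) :
    laurentSubring x s ≤ laurentSubring x t :=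
  Subring.closure_mono fun _ ⟨i, hi, hy⟩ => ⟨i, h hi, hy⟩

theorem laurentSubring_congr {x y : ι → F} {t : Set ι} (h : ∀ i ∈ t, x i = y i) :
    laurentSubring x t = laurentSubring y t := by
  refine congrArg Subring.closure (Set.ext fun z => ?_)
  constructor
  · rintro ⟨i, hi, hz⟩
    exact ⟨i, hi, by rwa [← h i hi]⟩
  · rintro ⟨i, hi, hz⟩
    exact ⟨i, hi, by rwa [h i hi]⟩

theorem mem_laurentSubring (x : ι → F) {t : Set ι} {i : ι} (hi : i ∈ t) :
    x i ∈ laurentSubring x t :=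
  Subring.subset_closure ⟨i, hi, Or.inl rfl⟩

theorem inv_mem_laurentSubring (x : ι → F) {t : Set ι} {i : ι} (hi : i ∈ t) :
    (x i)⁻¹ ∈ laurentSubring x t :=
  Subring.subset_closure ⟨i, hi, Or.inr rfl⟩

theorem zpow_mem_laurentSubring (x : ι → F) {t : Set ι} {i : ι} (hi : i ∈ t) (e : ℤ) :
    x i ^ e ∈ laurentSubring x t := by
  rcases e with e | e
  · rw [Int.ofNat_eq_natCast, zpow_natCast]
    exact Subring.pow_mem _ (mem_laurentSubring x hi) _
  · rw [zpow_negSucc, ← inv_pow]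
    exact Subring.pow_mem _ (inv_mem_laurentSubring x hi) _

theorem prod_zpow_mem_laurentSubring (x : ι → F) {t : Set ι} (s : Finset ι) {e : ι → ℤ}
    (he : ∀ i ∉ t, e i = 0) : ∏ i ∈ s, x i ^ e i ∈ laurentSubring x t := by
  refine Subring.prod_mem _ fun i _ => ?_
  by_cases hi : i ∈ t
  · exact zpow_mem_laurentSubring x hi _
  · rw [he i hi, zpow_zero]
    exact Subring.one_mem _

theorem laurentSubring_insert (x : ι → F) (k : ι) (t : Set ι) :
    laurentSubring x (insert k t) = laurentAdjoin (laurentSubring x t) (x k) := by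
  refine le_antisymm (Subring.closure_le.2 ?_)
    (laurentAdjoin_le (laurentSubring_mono x (Set.subset_insert k t))
      (mem_laurentSubring x (Set.mem_insert k t)) (inv_mem_laurentSubring x (Set.mem_insert k t)))
  rintro y ⟨i, rfl | hi, rfl | rfl⟩
  exacts [self_mem_laurentAdjoin _ _, inv_mem_laurentAdjoin _ _,
    le_laurentAdjoin _ _ (mem_laurentSubring x hi),
    le_laurentAdjoin _ _ (inv_mem_laurentSubring x hi)]

theorem laurentSubring_univ (x : ι → F) (k : ι) :
    laurentSubring x Set.univ = laurentAdjoin (laurentSubring x {k}ᶜ) (x k) := by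
  rw [← laurentSubring_insert]
  congr 1
  ext i
  simp [em]

theorem transcendental_of_le {K L : Subring F} (h : K ≤ L) {x : F} (hx : Transcendental L x) :
    Transcendental K x := by
  let := (Subring.inclusion h).toAlgebra
  have : IsScalarTower K L F := IsScalarTower.of_algebraMap_eq fun _ => rfl
  exact fun hK => hx (hK.extendScalars (Subring.inclusion_injective h))

variable [Algebra ℚ F]

theorem transcendental_laurentSubring {x : ι → F} (hx : AlgebraicIndependent ℚ x) {t : Set ι}
    {k : ι} (hk : k ∉ t) : Transcendental (laurentSubring x t) (x k) := by
  have h := IntermediateField.transcendental_adjoin_iff.2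
    (hx.transcendental_adjoin hk)
  refine transcendental_of_le (L := (IntermediateField.adjoin ℚ (x '' t)).toSubring) ?_ h
  refine Subring.closure_le.2 ?_
  have hm : ∀ i ∈ t, x i ∈ IntermediateField.adjoin ℚ (x '' t) := fun i hi =>
    IntermediateField.subset_adjoin _ _ ⟨i, hi, rfl⟩
  rintro y ⟨i, hi, rfl | rfl⟩
  exacts [hm i hi, IntermediateField.inv_mem _ (hm i hi)]

theorem prod_pow_add_prod_pow_ne_zero [Fintype ι] {x : ι → F} (hx : AlgebraicIndependent ℚ x)
    (a b : ι → ℕ) : ∏ i, x i ^ a i + ∏ i, x i ^ b i ≠ 0 := by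
  intro h
  have h0 : (∏ i, MvPolynomial.X i ^ a i + ∏ i, MvPolynomial.X i ^ b i : MvPolynomial ι ℚ) = 0 := by
    refine hx ?_
    simpa using h
  have := congrArg (MvPolynomial.eval fun _ => (1 : ℚ)) h0
  norm_num at this

end Laurent

/-! ### Transport of an exchange ring across a mutation at another index. -/

section Exchange

variable {F : Type*} [Field F]

/-- Since `β ≠ 0`, `x` divides `w`, so `1 + w` is 1 modulo `x`. The generators of the old ring enter
the new one after multiplication by powers of `1 + w`; as a polynomial in `x` over `K'` this factor
has constant term 1, so it can be cancelled by `mem_exchangeRing_of_mul_mem`. -/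
theorem mem_exchangeRing_mutate {C K K' : Subring F} {x xk xk' y y' w u m f : F} {β n : ℕ}
    (hK : K = laurentAdjoin C xk) (hK' : K' = laurentAdjoin C xk') (hx : Transcendental K' x)
    (hxk : xk ≠ 0) (hxk' : xk' ≠ 0) (hβ : β ≠ 0) (hw : w = x ^ β * u) (hu : u ∈ C)
    (hkk : xk * xk' = m * (1 + w)) (hm0 : m ≠ 0) (hm : m ∈ C) (hm' : m⁻¹ ∈ C) (hy' : y' ∈ K')
    (hyy : y' = y * (1 + w) ^ n ∨ y = y' * (1 + w) ^ n)
    (hf : f ∈ exchangeRing K x (1 + y)) (hf' : f ∈ laurentAdjoin K' x) :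
    f ∈ exchangeRing K' x (1 + y') := by
  have hx0 := ne_zero_of_transcendental hx
  set E := exchangeRing K' x (1 + y') with hE
  have hCK' : C ≤ K' := hK' ▸ le_laurentAdjoin _ _
  have hK'E : K' ≤ E := le_exchangeRing _ _ _
  have hCE := hCK'.trans hK'E
  have hxE : x ∈ E := self_mem_exchangeRing _ _ _
  have hwE : w ∈ E := hw ▸ E.mul_mem (E.pow_mem hxE _) (hCE hu)
  have hq : 1 + w ∈ E := E.add_mem E.one_mem hwE
  have hq0 : 1 + w ≠ 0 := by
    intro h
    rw [h, mul_zero] at hkk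
    exact mul_ne_zero hxk hxk' hkk
  have hdiv : ((1 + w) ^ n - 1) / x ∈ E := by
    obtain ⟨γ, rfl⟩ := Nat.exists_eq_succ_of_ne_zero hβ
    have : ((1 + w) ^ n - 1) / x = (∑ i ∈ Finset.range n, (1 + w) ^ i) * (x ^ γ * u) := by
      rw [← geom_sum_mul, add_sub_cancel_left, hw, mul_div_assoc]
      congr 1
      field_simp
      rw [Nat.succ_eq_add_one]
      ring
    rw [this]
    exact E.mul_mem (E.sum_mem fun i _ => E.pow_mem hq _) (E.mul_mem (E.pow_mem hxE _) (hCE hu))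
  have hED : E ≤ denomSubring E (1 + w) hq := fun g hg => ⟨0, by simpa using hg⟩
  -- Only `xk⁻¹`, and `(1 + y) / x` when `y' = y * (1 + w) ^ n`, need a denominator; the discrepancy
  -- in the latter is `hdiv`.
  have hle : exchangeRing K x (1 + y) ≤ denomSubring E (1 + w) hq := by
    refine exchangeRing_le ?_ (hED hxE) ?_
    · rw [hK]
      refine laurentAdjoin_le (hCE.trans hED) (hED ?_) ⟨1, ?_⟩
      · rw [← eq_div_iff hxk'] at hkk
        rw [hkk, div_eq_mul_inv]
        exact E.mul_mem (E.mul_mem (hCE hm) hq)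
          (hK'E (hK' ▸ inv_mem_laurentAdjoin _ _))
      · have : (1 + w) ^ 1 * xk⁻¹ = m⁻¹ * xk' := by
          field_simp
          rw [hkk]
          ring
        rw [this]
        exact E.mul_mem (hCE hm') (hK'E (hK' ▸ self_mem_laurentAdjoin _ _))
    · rcases hyy with h | h
      · refine ⟨n, ?_⟩
        have : (1 + w) ^ n * ((1 + y) / x) = ((1 + w) ^ n - 1) / x + (1 + y') / x := by
          rw [h]
          ring
        rw [this]
        exact E.add_mem hdiv (div_mem_exchangeRing _ _ _)
      · refine hED ?_
        have : (1 + y) / x = (1 + y') / x + y' * (((1 + w) ^ n - 1) / x) := by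
          rw [h]
          ring
        rw [this]
        exact E.add_mem (div_mem_exchangeRing _ _ _) (E.mul_mem (hK'E hy') hdiv)
  obtain ⟨N, hN⟩ := hle hf
  let Q : K'[X] := 1 + X ^ β * Polynomial.C ⟨u, hCK' hu⟩
  have hQ : aeval x Q = 1 + w := by
    simp only [Q, map_add, map_one, map_mul, map_pow, aeval_X, aeval_C, hw]
    rfl
  have hQ0 : Q.coeff 0 = 1 := by
    simp only [Q, coeff_add, coeff_one_zero, mul_coeff_zero, coeff_X_pow]
    simp [hβ.symm]
  have hP' : 1 + y' = ((⟨1 + y', K'.add_mem K'.one_mem hy'⟩ : K') : F) := rfl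
  rw [hE, hP'] at hN ⊢
  refine mem_exchangeRing_of_mul_mem hx hf' (Q := Q ^ N) ?_ ?_
  · rw [coeff_zero_eq_eval_zero, eval_pow, ← coeff_zero_eq_eval_zero, hQ0, one_pow]
    exact isUnit_one
  · rwa [map_pow, hQ]

end Exchange

/-! ### Mutation of skew-symmetric seeds and of their Laurent rings. -/

namespace SeedData

variable {n p : ℕ} {F : Type*}

theorem SkewSymmetric.B_self {T : SeedData n p F} (h : T.SkewSymmetric) (k : Fin n) :
    T.B (Sum.inl k) k = 0 := by
  have := h k k
  simp only [principal] at this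
  omega

theorem SkewSymmetric.B_swap {T : SeedData n p F} (h : T.SkewSymmetric) (i j : Fin n) :
    T.B (Sum.inl i) j = -T.B (Sum.inl j) i :=
  h i j

theorem SkewSymmetric.signSkewSymmetric {T : SeedData n p F} (h : T.SkewSymmetric) :
    T.SignSkewSymmetric := by
  intro i j
  have := h i j
  by_cases h0 : T.principal j i = 0
  · exact Or.inl ⟨by omega, h0⟩
  · refine Or.inr ?_
    rw [this, neg_mul]
    exact neg_neg_of_pos (mul_self_pos.2 h0)

variable [Field F]

/-- The column of `B̃` at `j` as a Laurent monomial in the extended cluster. -/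
def yhat (T : SeedData n p F) (j : Fin n) : F :=
  ∏ i, T.x i ^ T.B i j

/-- The coefficient ring of the exchange relation at `j`. -/
def coefRing (T : SeedData n p F) (j : Fin n) : Subring F :=
  laurentSubring T.x {Sum.inl j}ᶜ

theorem mutate_x_self (T : SeedData n p F) (k : Fin n) :
    (T.mutate k).x (Sum.inl k) = (T.x (Sum.inl k))⁻¹ *
      (∏ i, T.x i ^ (T.B i k).toNat + ∏ i, T.x i ^ (-T.B i k).toNat) := by
  simp [mutate]

theorem mutate_x_of_ne (T : SeedData n p F) (k : Fin n) {i : Fin n ⊕ Fin p} (h : i ≠ Sum.inl k) :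
    (T.mutate k).x i = T.x i := by
  simp [mutate, h]

theorem mutate_x_inr (T : SeedData n p F) (k : Fin n) (i : Fin p) :
    (T.mutate k).x (Sum.inr i) = T.x (Sum.inr i) :=
  T.mutate_x_of_ne k (by simp)

theorem mutate_B_col (T : SeedData n p F) (k : Fin n) (i : Fin n ⊕ Fin p) :
    (T.mutate k).B i k = -T.B i k := by
  simp [mutate]

theorem mutate_B_row (T : SeedData n p F) (k j : Fin n) :
    (T.mutate k).B (Sum.inl k) j = -T.B (Sum.inl k) j := by
  simp [mutate]

theorem mutate_B_of_pos (T : SeedData n p F) {k j : Fin n} {i : Fin n ⊕ Fin p}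
    (hi : i ≠ Sum.inl k) (hj : j ≠ k) (h : 0 ≤ T.B (Sum.inl k) j) :
    (T.mutate k).B i j = T.B i j + T.B (Sum.inl k) j * (T.B i k).toNat := by
  simp only [mutate, hi, hj, or_self, if_false, abs_of_nonneg h]
  rcases le_total 0 (T.B i k) with h' | h'
  · rw [abs_of_nonneg h', Int.toNat_of_nonneg h',
      show T.B i k * T.B (Sum.inl k) j + T.B i k * T.B (Sum.inl k) j =
        T.B (Sum.inl k) j * T.B i k * 2 by ring]
    simp
  · simp [abs_of_nonpos h', Int.toNat_of_nonpos h']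

theorem mutate_B_of_neg (T : SeedData n p F) {k j : Fin n} {i : Fin n ⊕ Fin p}
    (hi : i ≠ Sum.inl k) (hj : j ≠ k) (h : T.B (Sum.inl k) j ≤ 0) :
    (T.mutate k).B i j = T.B i j + T.B (Sum.inl k) j * (-T.B i k).toNat := by
  simp only [mutate, hi, hj, or_self, if_false, abs_of_nonpos h]
  rcases le_total 0 (T.B i k) with h' | h'
  · simp [abs_of_nonneg h', Int.toNat_of_nonpos (neg_nonpos.2 h')]
  · rw [abs_of_nonpos h', Int.toNat_of_nonneg (neg_nonneg.2 h'),
      show -T.B i k * T.B (Sum.inl k) j + T.B i k * -T.B (Sum.inl k) j =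
        T.B (Sum.inl k) j * -T.B i k * 2 by ring, Int.mul_ediv_cancel _ two_ne_zero]

theorem SkewSymmetric.mutate {T : SeedData n p F} (h : T.SkewSymmetric) (k : Fin n) :
    (T.mutate k).SkewSymmetric := by
  intro i j
  simp only [principal]
  by_cases hi : i = k
  · subst hi
    rw [mutate_B_row, mutate_B_col, h.B_swap i j]
  by_cases hj : j = k
  · subst hj
    rw [mutate_B_row, mutate_B_col, h.B_swap i j]
  have hi' : (Sum.inl i : Fin n ⊕ Fin p) ≠ Sum.inl k := by simpa using hi
  have hj' : (Sum.inl j : Fin n ⊕ Fin p) ≠ Sum.inl k := by simpa using hj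
  have e1 := h.B_swap i j
  have e2 := h.B_swap k i
  have e3 := h.B_swap k j
  rcases le_total 0 (T.B (Sum.inl k) j) with h1 | h1 <;>
    rcases le_total 0 (T.B (Sum.inl k) i) with h2 | h2
  · rw [mutate_B_of_pos T hi' hj h1, mutate_B_of_pos T hj' hi h2,
      Int.toNat_of_nonpos (by omega), Int.toNat_of_nonpos (by omega)]
    simp [e1]
  · rw [mutate_B_of_pos T hi' hj h1, mutate_B_of_neg T hj' hi h2,
      Int.toNat_of_nonneg (by omega), Int.toNat_of_nonneg (by omega), e1, e3, e2]
    ring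
  · rw [mutate_B_of_neg T hi' hj h1, mutate_B_of_pos T hj' hi h2,
      Int.toNat_of_nonneg (by omega), Int.toNat_of_nonneg (by omega), e1, e3, e2]
    ring
  · rw [mutate_B_of_neg T hi' hj h1, mutate_B_of_neg T hj' hi h2,
      Int.toNat_of_nonpos (by omega), Int.toNat_of_nonpos (by omega)]
    simp [e1]

theorem SkewSymmetric.mutates {T : SeedData n p F} (h : T.SkewSymmetric) (k : Fin n) :
    T.Mutates (T.mutate k) :=
  ⟨k, rfl, (h.mutate k).signSkewSymmetric⟩

theorem prod_mutate_x_pow (T : SeedData n p F) (k : Fin n) {e : Fin n ⊕ Fin p → ℕ}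
    (he : e (Sum.inl k) = 0) : ∏ i, (T.mutate k).x i ^ e i = ∏ i, T.x i ^ e i := by
  refine Finset.prod_congr rfl fun i _ => ?_
  by_cases hi : i = Sum.inl k
  · rw [hi, he, pow_zero, pow_zero]
  · rw [mutate_x_of_ne T k hi]

theorem yhat_mem_coefRing {T : SeedData n p F} (h : T.SkewSymmetric) (k : Fin n) :
    T.yhat k ∈ T.coefRing k := by
  refine prod_zpow_mem_laurentSubring T.x _ fun i hi => ?_
  rw [Set.notMem_compl_iff, Set.mem_singleton_iff] at hi
  rw [hi, h.B_self]

theorem coefRing_mutate (T : SeedData n p F) (k : Fin n) :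
    (T.mutate k).coefRing k = T.coefRing k :=
  laurentSubring_congr fun _ hi => mutate_x_of_ne T k hi

theorem prod_pow_mem {T : SeedData n p F} {t : Set (Fin n ⊕ Fin p)} {e : Fin n ⊕ Fin p → ℕ}
    (he : ∀ i ∉ t, e i = 0) : ∏ i, T.x i ^ e i ∈ laurentSubring T.x t ∧
      (∏ i, T.x i ^ e i)⁻¹ ∈ laurentSubring T.x t := by
  constructor
  · have := prod_zpow_mem_laurentSubring T.x Finset.univ (t := t) (e := fun i => (e i : ℤ))
      (fun i hi => by simp [he i hi])
    simpa using this
  · have := prod_zpow_mem_laurentSubring T.x Finset.univ (t := t) (e := fun i => -(e i : ℤ))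
      (fun i hi => by simp [he i hi])
    simpa using this

section Independent

variable [Algebra ℚ F]

theorem mutate_x_self_ne_zero {T : SeedData n p F} (hT : AlgebraicIndependent ℚ T.x) (k : Fin n) :
    (T.mutate k).x (Sum.inl k) ≠ 0 := by
  rw [mutate_x_self]
  exact mul_ne_zero (inv_ne_zero (hT.ne_zero _)) (prod_pow_add_prod_pow_ne_zero hT _ _)

theorem mutate_mutate {T : SeedData n p F} (hT : AlgebraicIndependent ℚ T.x)
    (h : T.SkewSymmetric) (k : Fin n) : (T.mutate k).mutate k = T := by
  have hx : ((T.mutate k).mutate k).x = T.x := by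
    funext i
    by_cases hi : i = Sum.inl k
    · subst hi
      rw [mutate_x_self (T.mutate k)]
      simp only [mutate_B_col, neg_neg]
      rw [prod_mutate_x_pow T k (by simp [h.B_self]), prod_mutate_x_pow T k (by simp [h.B_self]),
        mutate_x_self, add_comm (∏ i, T.x i ^ (-T.B i k).toNat), mul_inv, inv_inv, mul_assoc,
        inv_mul_cancel₀ (prod_pow_add_prod_pow_ne_zero hT _ _), mul_one]
    · rw [mutate_x_of_ne _ k hi, mutate_x_of_ne _ k hi]
  have hB : ((T.mutate k).mutate k).B = T.B := by
    funext i j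
    by_cases hi : i = Sum.inl k
    · subst hi
      rw [mutate_B_row, mutate_B_row, neg_neg]
    by_cases hj : j = k
    · subst hj
      rw [mutate_B_col, mutate_B_col, neg_neg]
    rcases le_total 0 (T.B (Sum.inl k) j) with h1 | h1
    · rw [mutate_B_of_neg (T.mutate k) hi hj (by rw [mutate_B_row]; omega), mutate_B_row,
        mutate_B_col, neg_neg, mutate_B_of_pos T hi hj h1]
      ring
    · rw [mutate_B_of_pos (T.mutate k) hi hj (by rw [mutate_B_row]; omega), mutate_B_row,
        mutate_B_col, mutate_B_of_neg T hi hj h1]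
      ring
  calc (T.mutate k).mutate k = ⟨((T.mutate k).mutate k).x, ((T.mutate k).mutate k).B⟩ := rfl
    _ = T := by rw [hx, hB]

/-- By the exchange relation `x_k` is `x_k'⁻¹` times a polynomial in the other variables, so
algebraicity of `x_k'` over these would pass to `x_k`. -/
theorem algebraicIndependent_mutate {T : SeedData n p F} (hT : AlgebraicIndependent ℚ T.x)
    (h : T.SkewSymmetric) (k : Fin n) : AlgebraicIndependent ℚ (T.mutate k).x := by
  have hk := (AlgebraicIndependent.iff_transcendental_adjoin_image (Sum.inl k)).1 hT
  refine (AlgebraicIndependent.iff_transcendental_adjoin_image (Sum.inl k)).2 ⟨?_, ?_⟩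
  · convert hk.1 using 1
    funext i
    exact mutate_x_of_ne T k i.2
  · have himage : (T.mutate k).x '' {Sum.inl k}ᶜ = T.x '' {Sum.inl k}ᶜ :=
      Set.image_congr fun i hi => mutate_x_of_ne T k hi
    rw [himage]
    intro halg
    refine hk.2 ?_
    have hmem : ∀ e : Fin n ⊕ Fin p → ℕ, e (Sum.inl k) = 0 →
        ∏ i, T.x i ^ e i ∈ Algebra.adjoin ℚ (T.x '' {Sum.inl k}ᶜ) := by
      intro e he
      refine Subalgebra.prod_mem _ fun i _ => ?_
      by_cases hi : i = Sum.inl k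
      · rw [hi, he, pow_zero]
        exact Subalgebra.one_mem _
      · exact Subalgebra.pow_mem _ (Algebra.subset_adjoin (Set.mem_image_of_mem T.x hi)) _
    have hs := Subalgebra.add_mem _ (hmem (fun i => (T.B i k).toNat) (by simp [h.B_self]))
      (hmem (fun i => (-T.B i k).toNat) (by simp [h.B_self]))
    have heq : T.x (Sum.inl k) = ((T.mutate k).x (Sum.inl k))⁻¹ *
        (∏ i, T.x i ^ (T.B i k).toNat + ∏ i, T.x i ^ (-T.B i k).toNat) := by
      rw [mutate_x_self, mul_inv, inv_inv, mul_assoc,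
        inv_mul_cancel₀ (prod_pow_add_prod_pow_ne_zero hT _ _), mul_one]
    have hs' := isAlgebraic_algebraMap (A := F) (Subtype.mk _ hs)
    rw [heq]
    exact halg.inv.mul hs'

theorem prod_pow_toNat {T : SeedData n p F} (hT : AlgebraicIndependent ℚ T.x) (k : Fin n) :
    ∏ i, T.x i ^ (T.B i k).toNat = (∏ i, T.x i ^ (-T.B i k).toNat) * T.yhat k := by
  rw [yhat, ← Finset.prod_mul_distrib]
  refine Finset.prod_congr rfl fun i _ => ?_
  rw [← zpow_natCast, ← zpow_natCast, ← zpow_add₀ (hT.ne_zero i)]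
  congr 1
  omega

theorem yhat_ne_zero {T : SeedData n p F} (hT : AlgebraicIndependent ℚ T.x) (k : Fin n) :
    T.yhat k ≠ 0 :=
  Finset.prod_ne_zero_iff.2 fun i _ => zpow_ne_zero _ (hT.ne_zero i)

theorem one_add_yhat_ne_zero {T : SeedData n p F} (hT : AlgebraicIndependent ℚ T.x) (k : Fin n) :
    1 + T.yhat k ≠ 0 := by
  intro h
  refine prod_pow_add_prod_pow_ne_zero hT (fun i => (T.B i k).toNat)
    (fun i => (-T.B i k).toNat) ?_
  linear_combination (∏ i, T.x i ^ (-T.B i k).toNat) * h + prod_pow_toNat hT k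

theorem transcendental_coefRing {T : SeedData n p F} (hT : AlgebraicIndependent ℚ T.x)
    (k : Fin n) : Transcendental (T.coefRing k) (T.x (Sum.inl k)) :=
  transcendental_laurentSubring hT (by simp)

/-- The Laurent ring of a mutated cluster, in terms of the original cluster. -/
theorem laurentSubring_mutate {T : SeedData n p F} (hT : AlgebraicIndependent ℚ T.x)
    (h : T.SkewSymmetric) (k : Fin n) : laurentSubring (T.mutate k).x Set.univ =
      laurentAdjoin (T.coefRing k) ((1 + T.yhat k) / T.x (Sum.inl k)) := by
  rw [laurentSubring_univ _ (Sum.inl k)]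
  change laurentAdjoin ((T.mutate k).coefRing k) _ = _
  rw [coefRing_mutate]
  set m := ∏ i, T.x i ^ (-T.B i k).toNat with hm
  obtain ⟨h1, h2⟩ := prod_pow_mem (T := T) (t := {Sum.inl k}ᶜ) (e := fun i => (-T.B i k).toNat)
    (fun i hi => by
      rw [Set.notMem_compl_iff, Set.mem_singleton_iff] at hi
      simp [hi, h.B_self])
  have hm0 : m ≠ 0 := Finset.prod_ne_zero_iff.2 fun i _ => pow_ne_zero _ (hT.ne_zero i)
  have e : (T.mutate k).x (Sum.inl k) = m * ((1 + T.yhat k) / T.x (Sum.inl k)) := by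
    rw [mutate_x_self, prod_pow_toNat hT]
    ring
  have e' : (1 + T.yhat k) / T.x (Sum.inl k) = m⁻¹ * (T.mutate k).x (Sum.inl k) := by
    rw [e, inv_mul_cancel_left₀ hm0]
  refine le_antisymm (laurentAdjoin_le (le_laurentAdjoin _ _) ?_ ?_)
    (laurentAdjoin_le (le_laurentAdjoin _ _) ?_ ?_)
  · rw [e]
    exact Subring.mul_mem _ (le_laurentAdjoin _ _ h1) (self_mem_laurentAdjoin _ _)
  · rw [e, mul_inv]
    exact Subring.mul_mem _ (le_laurentAdjoin _ _ h2) (inv_mem_laurentAdjoin _ _)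
  · rw [e']
    exact Subring.mul_mem _ (le_laurentAdjoin _ _ h2) (self_mem_laurentAdjoin _ _)
  · rw [e', mul_inv, inv_inv]
    exact Subring.mul_mem _ (le_laurentAdjoin _ _ h1) (inv_mem_laurentAdjoin _ _)

/-- Supplies the data for `mem_exchangeRing_mutate`. Here `β = |b_jk|`, and `w` is `ŷ_k` or its
inverse according to the sign of `b_jk`, so that `x_j` occurs in `w` with positive exponent; `m` is
the exchange monomial free of `x_j`. The last clause is the usual mutation rule for `ŷ_j`. -/
theorem exists_yhat_mutate {T : SeedData n p F} (hT : AlgebraicIndependent ℚ T.x)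
    (h : T.SkewSymmetric) {j k : Fin n} (hjk : T.B (Sum.inl j) k ≠ 0) :
    ∃ (w u m : F) (β : ℕ), β ≠ 0 ∧ w = T.x (Sum.inl j) ^ β * u ∧
      u ∈ laurentSubring T.x {Sum.inl j, Sum.inl k}ᶜ ∧
      T.x (Sum.inl k) * (T.mutate k).x (Sum.inl k) = m * (1 + w) ∧ m ≠ 0 ∧
      m ∈ laurentSubring T.x {Sum.inl j, Sum.inl k}ᶜ ∧
      m⁻¹ ∈ laurentSubring T.x {Sum.inl j, Sum.inl k}ᶜ ∧
      ((T.mutate k).yhat j = T.yhat j * (1 + w) ^ β ∨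
        T.yhat j = (T.mutate k).yhat j * (1 + w) ^ β) := by
  have hjk' : j ≠ k := by
    rintro rfl
    exact hjk (h.B_self j)
  have hne : ∀ e : Fin n ⊕ Fin p → ℕ, ∏ i, T.x i ^ e i ≠ 0 := fun e =>
    Finset.prod_ne_zero_iff.2 fun i _ => pow_ne_zero _ (hT.ne_zero i)
  have hxx : T.x (Sum.inl k) * (T.mutate k).x (Sum.inl k) =
      ∏ i, T.x i ^ (T.B i k).toNat + ∏ i, T.x i ^ (-T.B i k).toNat := by
    rw [mutate_x_self, mul_inv_cancel_left₀ (hT.ne_zero _)]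
  have hk0 := hT.ne_zero (Sum.inl k)
  have hk0' := mutate_x_self_ne_zero hT k
  have hsplit : ∀ (x : Fin n ⊕ Fin p → F) (e : Fin n ⊕ Fin p → ℤ),
      ∏ i, x i ^ e i = x (Sum.inl k) ^ e (Sum.inl k) *
        ∏ i ∈ Finset.univ.erase (Sum.inl k), x i ^ e i := fun x e =>
    (Finset.mul_prod_erase _ _ (Finset.mem_univ _)).symm
  have hsplitn : ∀ (e : Fin n ⊕ Fin p → ℕ), e (Sum.inl k) = 0 →
      ∏ i, T.x i ^ e i = ∏ i ∈ Finset.univ.erase (Sum.inl k), T.x i ^ (e i : ℤ) := by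
    intro e he
    rw [← Finset.mul_prod_erase _ _ (Finset.mem_univ (Sum.inl k)), he, pow_zero, one_mul]
    simp
  have hy' : (T.mutate k).yhat j = (T.mutate k).x (Sum.inl k) ^ (-T.B (Sum.inl k) j) *
      ∏ i ∈ Finset.univ.erase (Sum.inl k), T.x i ^ (T.mutate k).B i j := by
    rw [yhat, hsplit, mutate_B_row]
    congr 1
    refine Finset.prod_congr rfl fun i hi => ?_
    rw [mutate_x_of_ne T k (Finset.ne_of_mem_erase hi)]
  have hmem : ∀ {e : Fin n ⊕ Fin p → ℤ}, e (Sum.inl j) = 0 → e (Sum.inl k) = 0 →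
      ∀ i ∉ ({Sum.inl j, Sum.inl k}ᶜ : Set (Fin n ⊕ Fin p)), e i = 0 := by
    intro e h1 h2 i hi
    rw [Set.notMem_compl_iff] at hi
    rcases hi with rfl | rfl
    exacts [h1, h2]
  -- the Laurent monomial `w` divided by the power of `x j` that it contains
  have hdiv : ∀ e : Fin n ⊕ Fin p → ℤ, e (Sum.inl k) = 0 → ∃ u ∈
      laurentSubring T.x {Sum.inl j, Sum.inl k}ᶜ,
      ∏ i, T.x i ^ e i = T.x (Sum.inl j) ^ e (Sum.inl j) * u := by
    intro e he
    refine ⟨∏ i ∈ Finset.univ.erase (Sum.inl j), T.x i ^ e i, ?_,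
      (Finset.mul_prod_erase _ _ (Finset.mem_univ _)).symm⟩
    have : ∏ i ∈ Finset.univ.erase (Sum.inl j), T.x i ^ e i =
        ∏ i ∈ Finset.univ.erase (Sum.inl j), T.x i ^ Function.update e (Sum.inl j) 0 i :=
      Finset.prod_congr rfl fun i hi => by
        rw [Function.update_of_ne (Finset.ne_of_mem_erase hi)]
    rw [this]
    refine prod_zpow_mem_laurentSubring T.x _ (hmem (by simp) ?_)
    rw [Function.update_of_ne (by simpa using hjk'.symm), he]
  have hmn : ∀ {e : Fin n ⊕ Fin p → ℕ}, e (Sum.inl j) = 0 → e (Sum.inl k) = 0 →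
      ∀ i ∉ ({Sum.inl j, Sum.inl k}ᶜ : Set (Fin n ⊕ Fin p)), e i = 0 := by
    intro e h1 h2 i hi
    rw [Set.notMem_compl_iff] at hi
    rcases hi with rfl | rfl
    exacts [h1, h2]
  rcases lt_or_gt_of_ne hjk with hneg | hpos
  · obtain ⟨β, hβ⟩ := Int.eq_ofNat_of_zero_le (show 0 ≤ T.B (Sum.inl k) j by
      have := h.B_swap j k; omega)
    have hβ' : T.B (Sum.inl j) k = -β := by rw [h.B_swap, hβ]
    obtain ⟨u, hu, hwu⟩ := hdiv (fun i => -T.B i k) (by simp [h.B_self])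
    simp only [zpow_neg, Finset.prod_inv_distrib] at hwu
    change (T.yhat k)⁻¹ = _ at hwu
    rw [← zpow_neg, hβ', neg_neg, zpow_natCast] at hwu
    obtain ⟨h1, h2⟩ := prod_pow_mem (T := T) (t := {Sum.inl j, Sum.inl k}ᶜ)
      (e := fun i => (T.B i k).toNat) (hmn (Int.toNat_of_nonpos hneg.le) (by simp [h.B_self]))
    refine ⟨(T.yhat k)⁻¹, u, ∏ i, T.x i ^ (T.B i k).toNat, β, by omega, hwu, hu, ?_, hne _, h1, h2,
      Or.inr ?_⟩
    · rw [hxx, mul_add, mul_one, prod_pow_toNat hT,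
        mul_inv_cancel_right₀ (yhat_ne_zero hT k)]
    · have hkk : T.x (Sum.inl k) * (T.mutate k).x (Sum.inl k) =
          (∏ i, T.x i ^ (T.B i k).toNat) * (1 + (T.yhat k)⁻¹) := by
        rw [hxx, mul_add, mul_one, prod_pow_toNat hT, mul_inv_cancel_right₀ (yhat_ne_zero hT k)]
      have hq : 1 + (T.yhat k)⁻¹ = T.x (Sum.inl k) * (T.mutate k).x (Sum.inl k) /
          ∏ i, T.x i ^ (T.B i k).toNat := by
        rw [hkk, mul_div_cancel_left₀ _ (hne _)]
      have hprod : ∏ i ∈ Finset.univ.erase (Sum.inl k), T.x i ^ (T.mutate k).B i j =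
          (∏ i ∈ Finset.univ.erase (Sum.inl k), T.x i ^ T.B i j) *
            (∏ i, T.x i ^ (T.B i k).toNat) ^ β := by
        rw [hsplitn _ (by simp [h.B_self]), ← Finset.prod_pow, ← Finset.prod_mul_distrib]
        refine Finset.prod_congr rfl fun i hi => ?_
        rw [mutate_B_of_pos T (Finset.ne_of_mem_erase hi) hjk' (by omega), hβ,
          zpow_add₀ (hT.ne_zero i), mul_comm (β : ℤ), zpow_mul, zpow_natCast _ β]
      rw [hy', hq, yhat, hsplit, hprod, hβ, div_pow, mul_pow, zpow_neg, zpow_natCast, zpow_natCast]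
      have := hne fun i => (T.B i k).toNat
      field_simp
  · obtain ⟨β, hβ⟩ := Int.eq_ofNat_of_zero_le hpos.le
    have hβ' : T.B (Sum.inl k) j = -β := by rw [h.B_swap, hβ]
    obtain ⟨u, hu, hwu⟩ := hdiv (fun i => T.B i k) (by simp [h.B_self])
    change T.yhat k = _ at hwu
    rw [hβ, zpow_natCast] at hwu
    obtain ⟨h1, h2⟩ := prod_pow_mem (T := T) (t := {Sum.inl j, Sum.inl k}ᶜ)
      (e := fun i => (-T.B i k).toNat)
      (hmn (Int.toNat_of_nonpos (by omega)) (by simp [h.B_self]))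
    have hkk : T.x (Sum.inl k) * (T.mutate k).x (Sum.inl k) =
        (∏ i, T.x i ^ (-T.B i k).toNat) * (1 + T.yhat k) := by
      rw [hxx, mul_add, mul_one, prod_pow_toNat hT, add_comm]
    refine ⟨T.yhat k, u, ∏ i, T.x i ^ (-T.B i k).toNat, β, by omega, hwu, hu, hkk, hne _, h1, h2,
      Or.inl ?_⟩
    have hq : 1 + T.yhat k = T.x (Sum.inl k) * (T.mutate k).x (Sum.inl k) /
        ∏ i, T.x i ^ (-T.B i k).toNat := by
      rw [hkk, mul_div_cancel_left₀ _ (hne _)]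
    have hprod : (∏ i ∈ Finset.univ.erase (Sum.inl k), T.x i ^ T.B i j) =
        (∏ i ∈ Finset.univ.erase (Sum.inl k), T.x i ^ (T.mutate k).B i j) *
          (∏ i, T.x i ^ (-T.B i k).toNat) ^ β := by
      rw [hsplitn _ (by simp [h.B_self]), ← Finset.prod_pow, ← Finset.prod_mul_distrib]
      refine Finset.prod_congr rfl fun i hi => ?_
      rw [mutate_B_of_neg T (Finset.ne_of_mem_erase hi) hjk' (by omega), hβ',
        ← zpow_natCast _ β, ← zpow_mul, ← zpow_add₀ (hT.ne_zero i)]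
      congr 1
      ring
    rw [hy', hq, yhat, hsplit, hprod, hβ', div_pow, mul_pow, neg_neg, zpow_neg, zpow_natCast,
      zpow_natCast]
    have := hne fun i => (-T.B i k).toNat
    field_simp

theorem laurentSubring_inf_le_exchangeRing {T : SeedData n p F}
    (hT : AlgebraicIndependent ℚ T.x) (h : T.SkewSymmetric) (j : Fin n) :
    laurentSubring T.x Set.univ ⊓ laurentSubring (T.mutate j).x Set.univ ≤
      exchangeRing (T.coefRing j) (T.x (Sum.inl j)) (1 + T.yhat j) := by
  rw [laurentSubring_mutate hT h, laurentSubring_univ _ (Sum.inl j)]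
  exact laurentAdjoin_inf_le_exchangeRing (K := T.coefRing j)
    (P := ⟨1 + T.yhat j, Subring.add_mem _ (Subring.one_mem _) (yhat_mem_coefRing h j)⟩)
    (transcendental_coefRing hT j) fun h0 => one_add_yhat_ne_zero hT j (congrArg Subtype.val h0)

theorem exchangeRing_le_laurentSubring_mutate {T : SeedData n p F}
    (hT : AlgebraicIndependent ℚ T.x) (h : T.SkewSymmetric) (j : Fin n) :
    exchangeRing (T.coefRing j) (T.x (Sum.inl j)) (1 + T.yhat j) ≤
      laurentSubring (T.mutate j).x Set.univ := by
  rw [laurentSubring_mutate hT h]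
  refine exchangeRing_le (le_laurentAdjoin _ _) ?_ (self_mem_laurentAdjoin _ _)
  have : (1 + T.yhat j) * ((1 + T.yhat j) / T.x (Sum.inl j))⁻¹ = T.x (Sum.inl j) := by
    have := one_add_yhat_ne_zero hT j
    field_simp
  generalize (1 + T.yhat j) / T.x (Sum.inl j) = z at this ⊢
  rw [← this]
  exact Subring.mul_mem _ (le_laurentAdjoin _ _
    (Subring.add_mem _ (Subring.one_mem _) (yhat_mem_coefRing h j))) (inv_mem_laurentAdjoin _ _)

/-- The Laurent conditions at `T` and `T.mutate j` put `f` in the exchange ring at `j`; this is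
carried across the mutation at `k`, and then yields the Laurent ring two mutations away. -/
theorem mem_laurentSubring_mutate_mutate {T : SeedData n p F}
    (hT : AlgebraicIndependent ℚ T.x) (h : T.SkewSymmetric) {j k : Fin n}
    (hjk : T.B (Sum.inl j) k ≠ 0) {f : F} (hf : f ∈ laurentSubring T.x Set.univ)
    (hfj : f ∈ laurentSubring (T.mutate j).x Set.univ)
    (hfk : f ∈ laurentSubring (T.mutate k).x Set.univ) :
    f ∈ laurentSubring ((T.mutate k).mutate j).x Set.univ := by
  have hjk' : j ≠ k := by
    rintro rfl
    exact hjk (h.B_self j)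
  have hT' := algebraicIndependent_mutate hT h k
  have h' := h.mutate k
  obtain ⟨w, u, m, β, hβ, hw, hu, hkk, hm0, hm, hm', hyy⟩ := exists_yhat_mutate hT h hjk
  have hxj : (T.mutate k).x (Sum.inl j) = T.x (Sum.inl j) :=
    mutate_x_of_ne T k (by simpa using hjk')
  have hset : ({Sum.inl j}ᶜ : Set (Fin n ⊕ Fin p)) =
      insert (Sum.inl k) {Sum.inl j, Sum.inl k}ᶜ := by
    ext i
    by_cases hi : i = Sum.inl k
    · simp [hi, hjk'.symm]
    · simp [hi]
  refine exchangeRing_le_laurentSubring_mutate hT' h' j ?_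
  rw [hxj]
  refine mem_exchangeRing_mutate (C := laurentSubring T.x {Sum.inl j, Sum.inl k}ᶜ)
    (K := T.coefRing j) ?_ ?_ ?_ (hT.ne_zero _) (mutate_x_self_ne_zero hT k) hβ hw hu hkk hm0 hm hm'
    (yhat_mem_coefRing h' j) hyy (laurentSubring_inf_le_exchangeRing hT h j ⟨hf, hfj⟩) ?_
  · rw [coefRing, hset, laurentSubring_insert]
  · rw [coefRing, hset, laurentSubring_insert]
    congr 1
    refine laurentSubring_congr fun i hi => mutate_x_of_ne T k fun hik => ?_
    simp [hik] at hi
  · rw [← hxj]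
    exact transcendental_coefRing hT' j
  · rw [← hxj]
    rwa [laurentSubring_univ _ (Sum.inl j)] at hfk

end Independent

end SeedData

/-! ### Upper bounds and their invariance under mutation. -/

namespace SeedData

variable {n p : ℕ} {F : Type*} [Field F]

/-- The upper bound of a seed: the intersection of the Laurent rings of the cluster and of its
neighbours. -/
def upperBound (T : SeedData n p F) : Subring F :=
  laurentSubring T.x Set.univ ⊓ ⨅ k, laurentSubring (T.mutate k).x Set.univ

theorem mem_upperBound {T : SeedData n p F} {f : F} : f ∈ T.upperBound ↔
    f ∈ laurentSubring T.x Set.univ ∧ ∀ k, f ∈ laurentSubring (T.mutate k).x Set.univ := by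
  simp [upperBound, Subring.mem_inf, Subring.mem_iInf]

theorem MutationEquiv.x_inr {S T : SeedData n p F} (h : S.MutationEquiv T) (i : Fin p) :
    T.x (Sum.inr i) = S.x (Sum.inr i) := by
  induction h with
  | refl => rfl
  | tail _ hm ih =>
    obtain ⟨k, rfl, -⟩ := hm
    rw [mutate_x_inr, ih]

theorem MutationEquiv.skewSymmetric {S T : SeedData n p F} (h : S.MutationEquiv T)
    (hS : S.SkewSymmetric) : T.SkewSymmetric := by
  induction h with
  | refl => exact hS
  | tail _ hm ih =>
    obtain ⟨k, rfl, -⟩ := hm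
    exact ih.mutate k

theorem MutationEquiv.mutate {S T : SeedData n p F} (h : S.MutationEquiv T)
    (hS : S.SkewSymmetric) (k : Fin n) : S.MutationEquiv (T.mutate k) :=
  Relation.ReflTransGen.tail h ((h.skewSymmetric hS).mutates k)

theorem laurentRing_groundRing {S T : SeedData n p F} (h : S.MutationEquiv T) :
    laurentRing S.groundRing T = laurentSubring T.x Set.univ := by
  refine le_antisymm (Subring.closure_le.2 ?_) (Subring.closure_le.2 ?_)
  · rintro y (hy | ⟨i, rfl | rfl⟩)
    · have : S.groundRing ≤ laurentSubring T.x Set.univ := by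
        refine Subring.closure_le.2 ?_
        rintro y ⟨i, rfl | rfl⟩ <;> rw [← h.x_inr]
        exacts [mem_laurentSubring _ (Set.mem_univ _), inv_mem_laurentSubring _ (Set.mem_univ _)]
      exact this hy
    · exact mem_laurentSubring _ (Set.mem_univ _)
    · exact inv_mem_laurentSubring _ (Set.mem_univ _)
  · rintro y ⟨i | i, -, hy⟩
    · exact Subring.subset_closure (Or.inr ⟨i, hy⟩)
    · refine Subring.subset_closure (Or.inl (Subring.subset_closure ⟨i, ?_⟩))
      rwa [← h.x_inr]

section Independent

variable [Algebra ℚ F]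

theorem MutationEquiv.algebraicIndependent {S T : SeedData n p F} (h : S.MutationEquiv T)
    (hS : S.SkewSymmetric) (hx : AlgebraicIndependent ℚ S.x) : AlgebraicIndependent ℚ T.x := by
  induction h with
  | refl => exact hx
  | tail hT hm ih =>
    obtain ⟨k, rfl, -⟩ := hm
    exact algebraicIndependent_mutate ih (MutationEquiv.skewSymmetric hT hS) k

theorem upperBound_le_mutate {T : SeedData n p F} (hT : AlgebraicIndependent ℚ T.x)
    (h : T.SkewSymmetric) {k : Fin n} (hk : ∀ j, j ≠ k → T.B (Sum.inl j) k ≠ 0) :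
    T.upperBound ≤ (T.mutate k).upperBound := by
  intro f hf
  rw [mem_upperBound] at hf ⊢
  refine ⟨hf.2 k, fun j => ?_⟩
  by_cases hj : j = k
  · rw [hj, mutate_mutate hT h]
    exact hf.1
  · exact mem_laurentSubring_mutate_mutate hT h (hk j hj) hf.1 (hf.2 j) (hf.2 k)

theorem upperBound_mutate {T : SeedData n p F} (hT : AlgebraicIndependent ℚ T.x)
    (h : T.SkewSymmetric) {k : Fin n} (hk : ∀ j, j ≠ k → T.B (Sum.inl j) k ≠ 0) :
    (T.mutate k).upperBound = T.upperBound := by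
  refine le_antisymm ?_ (upperBound_le_mutate hT h hk)
  conv_rhs => rw [← mutate_mutate hT h k]
  refine upperBound_le_mutate (algebraicIndependent_mutate hT h k) (h.mutate k) fun j hj => ?_
  rw [mutate_B_col, neg_ne_zero]
  exact hk j hj

variable {S : SeedData n p F} (hx : AlgebraicIndependent ℚ S.x) (hS : S.SkewSymmetric)
  (h0 : ∀ T, S.MutationEquiv T → ∀ j k, j ≠ k → T.B (Sum.inl j) k ≠ 0)
include hx hS h0

theorem MutationEquiv.upperBound_eq {T : SeedData n p F} (h : S.MutationEquiv T) :
    T.upperBound = S.upperBound := by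
  induction h with
  | refl => rfl
  | tail hT hm ih =>
    obtain ⟨k, rfl, -⟩ := hm
    rw [upperBound_mutate (MutationEquiv.algebraicIndependent hT hS hx)
      (MutationEquiv.skewSymmetric hT hS) (h0 _ hT · k), ih]

theorem upperBound_le_upperClusterAlgebra : S.upperBound ≤ S.upperClusterAlgebra := by
  refine le_iInf fun T => ?_
  rw [laurentRing_groundRing T.2, ← MutationEquiv.upperBound_eq hx hS h0 T.2]
  exact inf_le_left

/-- A cluster variable clearly lies in the upper bound of its own seed, and all upper bounds
coincide. This contains the Laurent phenomenon for the seeds at hand. -/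
theorem clusterAlgebra_le_upperBound : S.clusterAlgebra ≤ S.upperBound := by
  refine Subring.closure_le.2 ?_
  rintro y (hy | ⟨T, hT, i, rfl⟩)
  · have hle : ∀ T, S.MutationEquiv T → S.groundRing ≤ laurentSubring T.x Set.univ := by
      intro T hT
      rw [← laurentRing_groundRing hT]
      exact fun z hz => Subring.subset_closure (Or.inl hz)
    exact mem_upperBound.2 ⟨hle S Relation.ReflTransGen.refl hy,
      fun k => hle _ (MutationEquiv.mutate Relation.ReflTransGen.refl hS k) hy⟩
  · rw [SetLike.mem_coe, ← MutationEquiv.upperBound_eq hx hS h0 hT, mem_upperBound]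
    refine ⟨mem_laurentSubring _ (Set.mem_univ _), fun k => ?_⟩
    have hx' := hT.algebraicIndependent hS hx
    have hS' := hT.skewSymmetric hS
    by_cases hi : i = k
    · subst hi
      refine exchangeRing_le_laurentSubring_mutate hx' hS' i ?_
      exact self_mem_exchangeRing _ _ _
    · rw [← mutate_x_of_ne T k (show Sum.inl i ≠ Sum.inl k by simpa using hi)]
      exact mem_laurentSubring _ (Set.mem_univ _)

end Independent

/-! ### Gradings encoded by a scaling endomorphism. -/

section Homogeneous

variable [Algebra ℚ F]

/-- The field has no direct sum grading, so degree is encoded by eigenvalues: homogeneous of degree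
`e` means eigenvector for `2 ^ e`. The endomorphism exists because `F` is the fraction field of the
polynomial ring in `x`. -/
theorem exists_scaling {ι : Type*} {x : ι → F} (hx : AlgebraicIndependent ℚ x)
    (htop : IntermediateField.adjoin ℚ (Set.range x) = ⊤) (w : ι → ℕ) :
    ∃ θ : F →+* F, ∀ i, θ (x i) = 2 ^ w i * x i := by
  let s : MvPolynomial ι ℚ →ₐ[ℚ] MvPolynomial ι ℚ :=
    MvPolynomial.aeval fun i => MvPolynomial.C (2 ^ w i) * MvPolynomial.X i
  let r : MvPolynomial ι ℚ →ₐ[ℚ] MvPolynomial ι ℚ :=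
    MvPolynomial.aeval fun i => MvPolynomial.C ((2 ^ w i)⁻¹) * MvPolynomial.X i
  have hrs : r.comp s = AlgHom.id ℚ _ := by
    ext1 i
    simp only [s, r, AlgHom.comp_apply, MvPolynomial.aeval_X, map_mul, AlgHom.id_apply]
    rw [← MvPolynomial.algebraMap_eq, AlgHom.commutes, ← mul_assoc, ← map_mul,
      mul_inv_cancel₀ (by positivity), map_one, one_mul]
  have hs : Function.Injective s := fun a b hab => by
    have := congrArg r hab
    rwa [← AlgHom.comp_apply, ← AlgHom.comp_apply, hrs] at this
  have hinj : Function.Injective ((MvPolynomial.aeval x : MvPolynomial ι ℚ →ₐ[ℚ] F).comp s) :=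
    (algebraicIndependent_iff_injective_aeval.1 hx).comp hs
  let g : FractionRing (MvPolynomial ι ℚ) →+* F := IsFractionRing.lift
    (g := (MvPolynomial.aeval x : MvPolynomial ι ℚ →ₐ[ℚ] F).toRingHom)
    (algebraicIndependent_iff_injective_aeval.1 hx)
  have hg : ∀ a, g (algebraMap (MvPolynomial ι ℚ) _ a) = MvPolynomial.aeval x a := fun a =>
    IsFractionRing.lift_algebraMap _ a
  have hsurj : Function.Surjective g := by
    have hle : IntermediateField.adjoin ℚ (Set.range x) ≤
        g.fieldRange.toIntermediateField fun q =>
          ⟨algebraMap (MvPolynomial ι ℚ) _ (MvPolynomial.C q), by simp [hg]⟩ := by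
      refine IntermediateField.adjoin_le_iff.2 ?_
      rintro _ ⟨i, rfl⟩
      exact ⟨algebraMap (MvPolynomial ι ℚ) _ (MvPolynomial.X i), by simp [hg]⟩
    intro y
    exact hle (htop ▸ IntermediateField.mem_top)
  let e₀ := RingEquiv.ofBijective g ⟨g.injective, hsurj⟩
  have he₀ : ∀ i, e₀ (algebraMap (MvPolynomial ι ℚ) _ (MvPolynomial.X i)) = x i := fun i =>
    (hg _).trans (by simp)
  refine ⟨(IsFractionRing.lift (K := FractionRing (MvPolynomial ι ℚ))
    (g := ((MvPolynomial.aeval x : MvPolynomial ι ℚ →ₐ[ℚ] F).comp s).toRingHom) hinj).comp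
      e₀.symm.toRingHom, fun i => ?_⟩
  rw [RingHom.comp_apply, ← he₀ i]
  change IsFractionRing.lift hinj (e₀.symm (e₀ _)) = _
  rw [RingEquiv.symm_apply_apply, IsFractionRing.lift_algebraMap, he₀]
  simp [s]

/-- A sum of eigenvectors for distinct powers of `2` that is itself an eigenvector is one of the
summands. -/
theorem eq_of_eigenvector_sum {θ : F →+* F} {d : ℕ} (s : Finset ℕ) (v : ℕ → F)
    (hv : ∀ e, θ (v e) = 2 ^ e * v e) (h : θ (∑ e ∈ s, v e) = 2 ^ d * ∑ e ∈ s, v e) :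
    ∑ e ∈ s, v e = if d ∈ s then v d else 0 := by
  have : CharZero F := algebraRat.charZero F
  have hind : ∀ (s : Finset ℕ) (v : ℕ → F), (∀ e, θ (v e) = 2 ^ e * v e) → ∑ e ∈ s, v e = 0 →
      ∀ e ∈ s, v e = 0 := by
    intro s
    induction s using Finset.induction_on with
    | empty => simp
    | insert a s ha ih =>
      intro v hv hsum
      -- Applying `θ - 2 ^ a` to the relation removes the summand `v a`.
      have h1 : ∀ e ∈ s, (2 ^ e - 2 ^ a) * v e = 0 := by
        refine ih (fun e => (2 ^ e - 2 ^ a) * v e) (fun e => ?_) ?_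
        · simp only [map_mul, map_sub, map_pow, map_ofNat, hv]
          ring
        · have h2 := congrArg θ hsum
          rw [map_zero, Finset.sum_insert ha, map_add, map_sum, hv] at h2
          rw [Finset.sum_insert ha] at hsum
          simp only [hv] at h2
          simp only [sub_mul, Finset.sum_sub_distrib, ← Finset.mul_sum]
          linear_combination h2 - 2 ^ a * hsum
      have h2 : ∀ e ∈ s, v e = 0 := fun e he => by
        refine (mul_eq_zero.1 (h1 e he)).resolve_left fun h => ha ?_
        have h3 : ((2 ^ e : ℕ) : F) = (2 ^ a : ℕ) := by
          push_cast
          exact sub_eq_zero.1 h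
        rwa [← Nat.pow_right_injective le_rfl (Nat.cast_injective h3)]
      intro e he
      rcases Finset.mem_insert.1 he with rfl | he
      · rwa [Finset.sum_insert ha, Finset.sum_eq_zero h2, add_zero] at hsum
      · exact h2 e he
  have h0 := hind s (fun e => (2 ^ e - 2 ^ d) * v e) (fun e => by
    simp only [map_mul, map_sub, map_pow, map_ofNat, hv]
    ring) (by
    simp only [sub_mul, Finset.sum_sub_distrib, ← Finset.mul_sum, ← h, map_sum, hv, sub_self])
  have hz : ∀ e ∈ s, e ≠ d → v e = 0 := fun e he hed => by
    refine (mul_eq_zero.1 (h0 e he)).resolve_left fun h => hed ?_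
    have h3 : ((2 ^ e : ℕ) : F) = (2 ^ d : ℕ) := by
      push_cast
      exact sub_eq_zero.1 h
    exact Nat.pow_right_injective le_rfl (Nat.cast_injective h3)
  split_ifs with hd
  · exact Finset.sum_eq_single_of_mem d hd hz
  · exact Finset.sum_eq_zero fun e he => hz e he fun h => hd (h ▸ he)

/-- If a ring is generated by homogeneous elements of nonnegative degrees and those of degree at
most `d` lie in `V`, then all its homogeneous elements of degree `d` lie in `V`. -/
theorem mem_of_mem_closure_of_eigenvector {θ : F →+* F} {V : Subring F} {d : ℕ} {G : Set F}
    (hG : ∀ g ∈ G, ∃ e : ℕ, θ g = 2 ^ e * g ∧ (e ≤ d → g ∈ V)) {f : F}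
    (hf : f ∈ Subring.closure G) (hfd : θ f = 2 ^ d * f) : f ∈ V := by
  -- Closure under products uses that degrees are nonnegative: if `e + e₁ ≤ d`, both factors have
  -- degree at most `d`.
  let M : Submonoid F :=
    { carrier := {g | ∃ e : ℕ, θ g = 2 ^ e * g ∧ (e ≤ d → g ∈ V)}
      one_mem' := ⟨0, by simp, fun _ => V.one_mem⟩
      mul_mem' := by
        rintro a b ⟨e, he, he'⟩ ⟨e₁, he₁, he₁'⟩
        refine ⟨e + e₁, ?_, fun h => V.mul_mem (he' (by omega)) (he₁' (by omega))⟩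
        rw [map_mul, he, he₁]
        ring }
  have hGM : Submonoid.closure G ≤ M := Submonoid.closure_le.2 hG
  rw [Subring.mem_closure_iff] at hf
  have key : ∃ (s : Finset ℕ) (v : ℕ → F), (∀ e, θ (v e) = 2 ^ e * v e ∧ (e ≤ d → v e ∈ V)) ∧
      (∀ e ∉ s, v e = 0) ∧ f = ∑ e ∈ s, v e := by
    clear hfd
    induction hf using AddSubgroup.closure_induction with
    | mem g hg =>
      obtain ⟨e, he, he'⟩ := hGM hg
      refine ⟨{e}, Pi.single e g, fun a => ?_, fun a ha => ?_, by simp⟩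
      · by_cases h : a = e
        · subst h
          simpa using ⟨he, he'⟩
        · simp [h]
      · rw [Pi.single_eq_of_ne (by simpa using ha)]
    | zero => exact ⟨∅, 0, by simp, by simp, by simp⟩
    | add a b _ _ ha hb =>
      obtain ⟨s, v, hv, hvs, rfl⟩ := ha
      obtain ⟨t, w, hw, hwt, rfl⟩ := hb
      refine ⟨s ∪ t, v + w, fun e => ⟨?_, fun h => V.add_mem ((hv e).2 h) ((hw e).2 h)⟩,
        fun e he => ?_, ?_⟩
      · rw [Pi.add_apply, map_add, (hv e).1, (hw e).1]
        ring
      · rw [Finset.notMem_union] at he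
        rw [Pi.add_apply, hvs e he.1, hwt e he.2, add_zero]
      · simp only [Pi.add_apply, Finset.sum_add_distrib]
        congr 1
        · exact Finset.sum_subset Finset.subset_union_left fun e _ => hvs e
        · exact Finset.sum_subset Finset.subset_union_right fun e _ => hwt e
    | neg a _ ha =>
      obtain ⟨s, v, hv, hvs, rfl⟩ := ha
      refine ⟨s, -v, fun e => ⟨?_, fun h => V.neg_mem ((hv e).2 h)⟩, fun e he => ?_, by simp⟩
      · rw [Pi.neg_apply, map_neg, (hv e).1]
        ring
      · rw [Pi.neg_apply, hvs e he, neg_zero]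
  obtain ⟨s, v, hv, -, rfl⟩ := key
  rw [eq_of_eigenvector_sum s v (fun e => (hv e).1) hfd]
  split_ifs
  · exact (hv d).2 le_rfl
  · exact V.zero_mem

end Homogeneous

end SeedData

/-! ### Rank three: cyclic triangles and the degrees of cluster variables. -/

namespace SeedData

section FinThree

theorem univ_fin_three {i j k : Fin 3} (hij : i ≠ j) (hjk : j ≠ k) (hki : k ≠ i) :
    (Finset.univ : Finset (Fin 3)) = {i, j, k} := by
  revert i j k
  decide

theorem sum_fin_three {M : Type*} [AddCommMonoid M] {i j k : Fin 3} (hij : i ≠ j) (hjk : j ≠ k)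
    (hki : k ≠ i) (f : Fin 3 → M) : ∑ l, f l = f i + (f j + f k) := by
  rw [univ_fin_three hij hjk hki, Finset.sum_insert (by simp [hij, hki.symm]),
    Finset.sum_insert (by simp [hjk]), Finset.sum_singleton]

theorem prod_fin_three {M : Type*} [CommMonoid M] {i j k : Fin 3} (hij : i ≠ j) (hjk : j ≠ k)
    (hki : k ≠ i) (f : Fin 3 → M) : ∏ l, f l = f i * (f j * f k) := by
  rw [univ_fin_three hij hjk hki, Finset.prod_insert (by simp [hij, hki.symm]),
    Finset.prod_insert (by simp [hjk]), Finset.prod_singleton]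

theorem eq_or_eq_or_eq_fin_three {i j k : Fin 3} (hij : i ≠ j) (hjk : j ≠ k) (hki : k ≠ i)
    (l : Fin 3) : l = i ∨ l = j ∨ l = k := by
  have := Finset.mem_univ l
  rw [univ_fin_three hij hjk hki] at this
  simpa using this

theorem exists_fin_three (k : Fin 3) : ∃ i j : Fin 3, i ≠ j ∧ j ≠ k ∧ k ≠ i := by
  revert k
  decide

end FinThree

variable {p : ℕ} {F : Type*}

/-- The quiver of the principal part is a cyclically oriented triangle. -/
def IsCyclic (T : SeedData 3 p F) : Prop :=
  ∀ i j k : Fin 3, i ≠ j → j ≠ k → k ≠ i →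
    (0 < T.B (Sum.inl i) j ∧ 0 < T.B (Sum.inl j) k ∧ 0 < T.B (Sum.inl k) i) ∨
      (T.B (Sum.inl i) j < 0 ∧ T.B (Sum.inl j) k < 0 ∧ T.B (Sum.inl k) i < 0)

/-- Skew-symmetry excludes loops and 2-cycles, so an oriented cycle on three vertices yields a
3-cycle through all of them. -/
theorem SkewSymmetric.isCyclic {T : SeedData 3 p F} (h : T.SkewSymmetric) (hT : ¬ T.IsAcyclic) :
    T.IsCyclic := by
  simp only [IsAcyclic, not_forall, not_not] at hT
  obtain ⟨i, hi⟩ := hT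
  have hne : ∀ {a b : Fin 3}, 0 < T.principal a b → a ≠ b := by
    rintro a b hab rfl
    have := h a a
    omega
  have hanti : ∀ {a b : Fin 3}, 0 < T.principal a b → ¬ 0 < T.principal b a := by
    intro a b hab hba
    have := h a b
    omega
  obtain ⟨j, hij, hji⟩ := Relation.TransGen.head'_iff.1 hi
  obtain ⟨m, -, hmi⟩ := Relation.TransGen.tail'_iff.1 hi
  have hjm : j ≠ m := by
    rintro rfl
    exact hanti hij hmi
  obtain hji | ⟨l, hjl, -⟩ := Relation.ReflTransGen.cases_head hji
  · exact absurd hji (hne hij).symm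
  have hlm : l = m := by
    rcases eq_or_eq_or_eq_fin_three (hne hij) hjm (hne hmi) l with rfl | rfl | rfl
    · exact absurd hjl (hanti hij)
    · exact absurd rfl (hne hjl)
    · rfl
  subst hlm
  intro a b c hab hbc hca
  have e1 := h.B_swap i j
  have e2 := h.B_swap j l
  have e3 := h.B_swap l i
  have n1 := hne hij
  have n2 := hne hjl
  have n3 := hne hmi
  simp only [principal] at hij hjl hmi
  rcases eq_or_eq_or_eq_fin_three n1 n2 n3 a with rfl | rfl | rfl <;>
  rcases eq_or_eq_or_eq_fin_three n1 n2 n3 b with rfl | rfl | rfl <;>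
  rcases eq_or_eq_or_eq_fin_three n1 n2 n3 c with rfl | rfl | rfl <;>
  first | exact absurd rfl hab | exact absurd rfl hbc | exact absurd rfl hca | omega

/-- The degree of the cluster variable at `l` in the grading for which the frozen variables have
degree zero: the absolute value of the entry of the principal part that is opposite to `l`. -/
def deg (T : SeedData 3 p F) (l : Fin 3) : ℕ :=
  (T.principal (l + 1) (l + 2)).natAbs

theorem SkewSymmetric.natAbs_eq_deg {T : SeedData 3 p F} (h : T.SkewSymmetric) {i j k : Fin 3}
    (hij : i ≠ j) (hjk : j ≠ k) (hki : k ≠ i) : (T.B (Sum.inl i) j).natAbs = T.deg k := by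
  have e : (i = k + 1 ∧ j = k + 2) ∨ (j = k + 1 ∧ i = k + 2) := by
    revert i j k
    decide
  rcases e with ⟨rfl, rfl⟩ | ⟨rfl, rfl⟩
  · rfl
  · rw [h.B_swap, Int.natAbs_neg]
    rfl

/-- The dictionary: `a`, `b`, `c` are the degrees at `σ 2`, `σ 0`, `σ 1`. -/
theorem isRoot_iff {T : SeedData 3 p F} (h : T.SkewSymmetric) (σ : Equiv.Perm (Fin 3)) :
    T.IsRoot σ ↔ T.deg (σ 1) ≤ T.deg (σ 0) ∧ T.deg (σ 0) ≤ T.deg (σ 2) ∧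
      2 * T.deg (σ 2) ≤ T.deg (σ 0) * T.deg (σ 1) ∧ 2 * T.deg (σ 0) ≤ T.deg (σ 2) * T.deg (σ 1) ∧
      2 * T.deg (σ 1) ≤ T.deg (σ 2) * T.deg (σ 0) := by
  have h01 : σ 0 ≠ σ 1 := σ.injective.ne (by decide)
  have h12 : σ 1 ≠ σ 2 := σ.injective.ne (by decide)
  have h20 : σ 2 ≠ σ 0 := σ.injective.ne (by decide)
  simp only [IsRoot, Int.abs_eq_natAbs, principal]
  rw [h.natAbs_eq_deg h01 h12 h20, h.natAbs_eq_deg h12 h20 h01, h.natAbs_eq_deg h20 h01 h12]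
  zify
  constructor
  · rintro ⟨h1, h2, h3, h4, h5⟩
    exact ⟨h1, h2, by linarith, by linarith, by linarith⟩
  · rintro ⟨h1, h2, h3, h4, h5⟩
    exact ⟨h1, h2, by linarith, by linarith, by linarith⟩

theorem IsCyclic.B_ne_zero {T : SeedData 3 p F} (h : T.IsCyclic) {j k : Fin 3} (hjk : j ≠ k) :
    T.B (Sum.inl j) k ≠ 0 := by
  obtain ⟨i, h1, h2⟩ : ∃ i : Fin 3, k ≠ i ∧ i ≠ j := by
    revert j k
    decide
  have := h j k i hjk h1 h2
  omega

theorem IsCyclic.deg_pos {T : SeedData 3 p F} (h : T.IsCyclic) (l : Fin 3) : 0 < T.deg l := by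
  refine Int.natAbs_pos.2 (h.B_ne_zero ?_)
  revert l
  decide

variable [Field F]

/-- Mutation changes the edge opposite to `k` to plus or minus the product of the other two minus
itself; cyclicity of the mutated triangle decides the sign. -/
theorem deg_mutate_self {T : SeedData 3 p F} (h : T.SkewSymmetric) (hc : T.IsCyclic) {i j k : Fin 3}
    (hij : i ≠ j) (hjk : j ≠ k) (hki : k ≠ i) (hc' : (T.mutate k).IsCyclic) :
    (T.mutate k).deg k + T.deg k = T.deg i * T.deg j := by
  rw [← h.natAbs_eq_deg hij hjk hki, ← (h.mutate k).natAbs_eq_deg hij hjk hki,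
    ← h.natAbs_eq_deg hjk hki hij, ← h.natAbs_eq_deg hki hij hjk]
  have h1 := hc i j k hij hjk hki
  have h2 := hc' i j k hij hjk hki
  rw [mutate_B_col, mutate_B_row] at h2
  have hi : (Sum.inl i : Fin 3 ⊕ Fin p) ≠ Sum.inl k := by simpa using hki.symm
  have e1 := h.B_swap k j
  have e2 := h.B_swap i k
  rcases h1 with ⟨h3, h4, h5⟩ | ⟨h3, h4, h5⟩
  · have e := mutate_B_of_neg T hi hjk (by omega)
    rw [e2, e1, neg_neg, Int.toNat_of_nonneg h5.le] at e
    zify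
    rw [abs_of_neg (by omega), abs_of_pos h3, abs_of_pos h4, abs_of_pos h5]
    linarith
  · have e := mutate_B_of_pos T hi hjk (by omega)
    rw [e2, e1, Int.toNat_of_nonneg (by omega)] at e
    zify
    rw [abs_of_pos (by omega), abs_of_neg h3, abs_of_neg h4, abs_of_neg h5]
    linarith

theorem deg_mutate_of_ne {T : SeedData 3 p F} (h : T.SkewSymmetric) {k l : Fin 3} (hl : l ≠ k) :
    (T.mutate k).deg l = T.deg l := by
  obtain ⟨i, h1, h2⟩ : ∃ i : Fin 3, k ≠ i ∧ i ≠ l := by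
    revert k l
    decide
  rw [← (h.mutate k).natAbs_eq_deg h1 h2 hl, ← h.natAbs_eq_deg h1 h2 hl, mutate_B_row,
    Int.natAbs_neg]

end SeedData

/-! ### The seed-independent grading, and growth of degrees away from a root. -/

namespace SeedData

variable {p : ℕ} {F : Type*} [Field F]

/-- The ring endomorphism `θ` scales each cluster variable by `2` to the power of its degree. -/
def IsScaledBy (T : SeedData 3 p F) (θ : F →+* F) : Prop :=
  ∀ i, θ (T.x i) = 2 ^ Sum.elim T.deg (0 : Fin p → ℕ) i * T.x i

theorem map_prod_pow {ι : Type*} [Fintype ι] {x : ι → F} {θ : F →+* F} {w : ι → ℕ}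
    (hθ : ∀ i, θ (x i) = 2 ^ w i * x i) (e : ι → ℕ) :
    θ (∏ i, x i ^ e i) = 2 ^ (∑ i, w i * e i) * ∏ i, x i ^ e i := by
  rw [map_prod, ← Finset.prod_pow_eq_pow_sum, ← Finset.prod_mul_distrib]
  refine Finset.prod_congr rfl fun i _ => ?_
  rw [map_pow, hθ, mul_pow, pow_mul]

/-- In a cyclic triangle the two exchange monomials at `k` are, up to frozen factors, `x_i ^ deg j`
and `x_j ^ deg i`, both of degree `deg i * deg j`; dividing by `x_k` gives the new degree of
`deg_mutate_self`. -/
theorem IsScaledBy.mutate [Algebra ℚ F] {T : SeedData 3 p F} {θ : F →+* F} (hθ : T.IsScaledBy θ)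
    (hT : AlgebraicIndependent ℚ T.x) (h : T.SkewSymmetric) (hc : T.IsCyclic) {k : Fin 3}
    (hc' : (T.mutate k).IsCyclic) : (T.mutate k).IsScaledBy θ := by
  have : CharZero F := algebraRat.charZero F
  intro l
  by_cases hl : l = Sum.inl k
  · subst hl
    obtain ⟨i, j, hij, hjk, hki⟩ := exists_fin_three k
    have hd := deg_mutate_self h hc hij hjk hki hc'
    have h1 := hc i j k hij hjk hki
    have e1 := h.natAbs_eq_deg hjk hki hij
    have e2 := h.natAbs_eq_deg hki hij hjk
    have e3 := h.B_swap i k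
    have e4 := h.B_self k
    have hs : θ (∏ i, T.x i ^ (T.B i k).toNat + ∏ i, T.x i ^ (-T.B i k).toNat) =
        2 ^ (T.deg i * T.deg j) *
          (∏ i, T.x i ^ (T.B i k).toNat + ∏ i, T.x i ^ (-T.B i k).toNat) := by
      rw [map_add, map_prod_pow hθ, map_prod_pow hθ, mul_add]
      congr 3 <;>
      · rw [Fintype.sum_sum_type, sum_fin_three hij hjk hki]
        simp only [Sum.elim_inl, Sum.elim_inr, Pi.zero_apply, zero_mul, Finset.sum_const_zero, e4,
          neg_zero, Int.toNat_zero, mul_zero, add_zero]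
        rcases h1 with h1 | h1
        · first
          | rw [show (T.B (Sum.inl i) k).toNat = 0 by omega,
              show (T.B (Sum.inl j) k).toNat = T.deg i by omega]
            ring
          | rw [show (-T.B (Sum.inl i) k).toNat = T.deg j by omega,
              show (-T.B (Sum.inl j) k).toNat = 0 by omega]
            ring
        · first
          | rw [show (T.B (Sum.inl i) k).toNat = T.deg j by omega,
              show (T.B (Sum.inl j) k).toNat = 0 by omega]
            ring
          | rw [show (-T.B (Sum.inl i) k).toNat = 0 by omega,
              show (-T.B (Sum.inl j) k).toNat = T.deg i by omega]
            ring
    have h0 := hT.ne_zero (Sum.inl k)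
    have h2 : (2 : F) ≠ 0 := two_ne_zero
    have hk := hθ (Sum.inl k)
    rw [Sum.elim_inl] at hk ⊢
    rw [mutate_x_self, map_mul, map_inv₀, hs, hk, ← hd, pow_add]
    field_simp
  · rw [mutate_x_of_ne T k hl, hθ]
    rcases l with l | l
    · rw [Sum.elim_inl, Sum.elim_inl, deg_mutate_of_ne h (by simpa using hl)]
    · rfl

theorem MutationEquiv.isScaledBy [Algebra ℚ F] {S T : SeedData 3 p F} (hT : S.MutationEquiv T)
    (hx : AlgebraicIndependent ℚ S.x) (hS : S.SkewSymmetric)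
    (hc : ∀ T, S.MutationEquiv T → T.IsCyclic) {θ : F →+* F} (hθ : S.IsScaledBy θ) :
    T.IsScaledBy θ := by
  induction hT with
  | refl => exact hθ
  | tail hT hm ih =>
    obtain ⟨k, rfl, -⟩ := hm
    exact ih.mutate (MutationEquiv.algebraicIndependent hT hS hx)
      (MutationEquiv.skewSymmetric hT hS) (hc _ hT) (hc _ (MutationEquiv.mutate hT hS k))

/-- A seed of minimal total degree is a root. -/
theorem exists_isRoot {S : SeedData 3 p F} (hS : S.SkewSymmetric)
    (hc : ∀ T, S.MutationEquiv T → T.IsCyclic) : ∃ T σ, S.MutationEquiv T ∧ T.IsRoot σ := by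
  obtain ⟨T, hT, hmin⟩ := WellFounded.has_min (measure fun T : SeedData 3 p F => ∑ l, T.deg l).wf
    {T | S.MutationEquiv T} ⟨S, Relation.ReflTransGen.refl⟩
  have hsk := MutationEquiv.skewSymmetric hT hS
  have hle : ∀ i j k : Fin 3, i ≠ j → j ≠ k → k ≠ i → 2 * T.deg k ≤ T.deg i * T.deg j := by
    intro i j k hij hjk hki
    have h1 := hmin (T.mutate k) (MutationEquiv.mutate hT hS k)
    have h2 := deg_mutate_self hsk (hc T hT) hij hjk hki (hc _ (MutationEquiv.mutate hT hS k))
    have h3 : ¬ ∑ l, (T.mutate k).deg l < ∑ l, T.deg l := h1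
    rw [sum_fin_three hij hjk hki, sum_fin_three hij hjk hki, deg_mutate_of_ne hsk hki.symm,
      deg_mutate_of_ne hsk hjk] at h3
    omega
  -- The root order is `deg (σ 1) ≤ deg (σ 0) ≤ deg (σ 2)`, hence the swap after sorting
  -- increasingly.
  refine ⟨T, (Equiv.swap 0 1).trans (Tuple.sort T.deg), hT, (isRoot_iff hsk _).2 ?_⟩
  have hmono := Tuple.monotone_sort T.deg
  have hinj := (Tuple.sort T.deg).injective
  have h01 := hinj.ne (show (0 : Fin 3) ≠ 1 by decide)
  have h12 := hinj.ne (show (1 : Fin 3) ≠ 2 by decide)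
  have h20 := hinj.ne (show (2 : Fin 3) ≠ 0 by decide)
  simp only [Equiv.trans_apply, Equiv.swap_apply_left, Equiv.swap_apply_right,
    show Equiv.swap (0 : Fin 3) 1 2 = 2 by decide]
  exact ⟨hmono (show (0 : Fin 3) ≤ 1 by decide), hmono (show (1 : Fin 3) ≤ 2 by decide),
    hle _ _ _ h01.symm h20.symm h12.symm, hle _ _ _ h20 h01 h12, hle _ _ _ h12.symm h01.symm h20.symm⟩

/-- The seeds obtained by mutation sequences without immediate repetitions, with the index of the
last mutation. -/
inductive ReducedFrom (T : SeedData 3 p F) : SeedData 3 p F → Option (Fin 3) → Prop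
  | nil : ReducedFrom T T none
  | cons {T' : SeedData 3 p F} {o : Option (Fin 3)} {k : Fin 3} :
      ReducedFrom T T' o → o ≠ some k → ReducedFrom T (T'.mutate k) (some k)

theorem ReducedFrom.mutationEquiv {T T' : SeedData 3 p F} {o : Option (Fin 3)}
    (h : T.ReducedFrom T' o) (hT : T.SkewSymmetric) : T.MutationEquiv T' := by
  induction h with
  | nil => exact Relation.ReflTransGen.refl
  | cons _ _ ih => exact ih.mutate hT _

theorem MutationEquiv.exists_reducedFrom [Algebra ℚ F] {T T' : SeedData 3 p F}
    (h : T.MutationEquiv T') (hx : AlgebraicIndependent ℚ T.x) (hT : T.SkewSymmetric) :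
    ∃ o, T.ReducedFrom T' o := by
  induction h with
  | refl => exact ⟨none, .nil⟩
  | tail _ hm ih =>
    obtain ⟨k, rfl, -⟩ := hm
    obtain ⟨o, ho⟩ := ih
    by_cases hok : o = some k
    · cases ho with
      | nil => simp at hok
      | cons h' hne =>
        obtain rfl := Option.some_injective _ hok
        have he := h'.mutationEquiv hT
        rw [mutate_mutate (he.algebraicIndependent hT hx) (he.skewSymmetric hT)]
        exact ⟨_, h'⟩
    · exact ⟨_, .cons ho hok⟩

section Root

variable {T : SeedData 3 p F}
  (hc : ∀ T', T.MutationEquiv T' → T'.IsCyclic) {i j k : Fin 3} (hij : i ≠ j) (hjk : j ≠ k)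
  (hki : k ≠ i) (hji : T.deg j ≤ T.deg i) (hik : T.deg i ≤ T.deg k)
  (hk : 2 * T.deg k ≤ T.deg i * T.deg j)
include hc hij hjk hki hji hik hk

/-- If the smallest degree were 1, then `2 * deg k ≤ deg i ≤ deg k`, contradicting positivity. -/
theorem two_le_deg_of_root (l : Fin 3) : 2 ≤ T.deg l := by
  have h0 := (hc T Relation.ReflTransGen.refl).deg_pos i
  have hj : 2 ≤ T.deg j := by
    by_contra hlt
    have : T.deg i * T.deg j ≤ T.deg i * 1 := Nat.mul_le_mul_left _ (by omega)
    omega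
  rcases eq_or_eq_or_eq_fin_three hij hjk hki l with rfl | rfl | rfl <;> omega

/-- The index `m` mutated last carries the largest degree. A mutation at `n ≠ m` produces `deg m *
deg l - deg n ≥ 2 * deg m - deg m`, so new degrees never drop. The threshold `deg k * deg j - deg i`
is the degree produced by mutating the root at `i`; only a first mutation at `k` may stay below it.
-/
theorem ReducedFrom.deg_le (hT : T.SkewSymmetric) {T' : SeedData 3 p F} {o : Option (Fin 3)} (h : T.ReducedFrom T' o) :
    (∀ l, 2 ≤ T'.deg l) ∧ (o = none → T' = T) ∧
      (∀ m, o = some m → (∀ l, T'.deg l ≤ T'.deg m) ∧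
        (T.deg k * T.deg j ≤ T'.deg m + T.deg i ∨ m = k ∧ T' = T.mutate k)) ∧
      ∀ l, T'.x (Sum.inl l) = (T.mutate k).x (Sum.inl k) ∨ T'.x (Sum.inl l) = T.x (Sum.inl l) ∨
        T.deg k * T.deg j ≤ T'.deg l + T.deg i := by
  have hT2 := two_le_deg_of_root hc hij hjk hki hji hik hk
  induction h with
  | nil => exact ⟨hT2, fun _ => rfl, fun m hm => by simp at hm, fun l => Or.inr (Or.inl rfl)⟩
  | @cons T' o n h hon ih =>
    obtain ⟨ih2, ihn, ihs, ihx⟩ := ih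
    have he := h.mutationEquiv hT
    have hsk := he.skewSymmetric hT
    have hc1 := hc _ he
    have hc2 := hc _ (he.mutate hT n)
    have hcomb : (T'.deg n ≤ (T'.mutate n).deg n ∧ ∀ l, T'.deg l ≤ (T'.mutate n).deg n) ∧
        (T.deg k * T.deg j ≤ (T'.mutate n).deg n + T.deg i ∨ n = k ∧ T' = T) := by
      rcases o with _ | m
      · obtain rfl := ihn rfl
        have hi2 := hT2 i
        have hj2 := hT2 j
        have di := deg_mutate_self hsk hc1 hjk hki hij
        have dj := deg_mutate_self hsk hc1 hki hij hjk
        have dk := deg_mutate_self hsk hc1 hij hjk hki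
        have hall : ∀ N, T'.deg k ≤ N → ∀ l, T'.deg l ≤ N := by
          intro N hN l
          rcases eq_or_eq_or_eq_fin_three hij hjk hki l with rfl | rfl | rfl <;> omega
        have hbig : T'.deg k * T'.deg j ≥ 2 * T'.deg k := by nlinarith
        have hbig' : T'.deg k * T'.deg i ≥ T'.deg k * T'.deg j + (T'.deg i - T'.deg j) := by
          obtain ⟨e, he⟩ := Nat.exists_eq_add_of_le hji
          rw [he, Nat.add_sub_cancel_left]
          nlinarith [hT2 k]
        rcases eq_or_eq_or_eq_fin_three hij hjk hki n with rfl | rfl | rfl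
        · have := di hc2
          rw [mul_comm] at this
          exact ⟨⟨by omega, hall _ (by omega)⟩, Or.inl (by omega)⟩
        · have := dj hc2
          exact ⟨⟨by omega, hall _ (by omega)⟩, Or.inl (by omega)⟩
        · have := dk hc2
          exact ⟨⟨by omega, hall _ (by omega)⟩, Or.inr ⟨rfl, rfl⟩⟩
      · have hmn : m ≠ n := fun e => hon (by rw [e])
        obtain ⟨hmax, hor⟩ := ihs m rfl
        obtain ⟨l, hnl, hlm⟩ : ∃ l : Fin 3, n ≠ l ∧ l ≠ m := by
          clear * - hmn
          revert m n
          decide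
        have d := deg_mutate_self hsk hc1 hlm hmn hnl hc2
        have h2l := ih2 l
        have hnm := hmax n
        have hm' : T'.deg m ≤ (T'.mutate n).deg n := by nlinarith
        refine ⟨⟨by omega, fun l => (hmax l).trans hm'⟩, Or.inl ?_⟩
        rcases hor with hor | ⟨rfl, rfl⟩
        · omega
        -- The step after the exceptional mutation at `k`: the degree at `k` has not decreased, so
        -- mutating at `i` or `j` gives at least what it would give at the root.
        · have di := deg_mutate_of_ne hT hki.symm
          have dj := deg_mutate_of_ne hT hjk
          have dk := deg_mutate_self hT (hc T Relation.ReflTransGen.refl) hij hjk hki hc1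
          have hge : T.deg m ≤ (T.mutate m).deg m := by omega
          rcases eq_or_eq_or_eq_fin_three hij hjk hki n with rfl | rfl | rfl
          · obtain rfl : l = j := by
              rcases eq_or_eq_or_eq_fin_three hij hjk hki l with rfl | rfl | rfl
              exacts [absurd rfl hnl, rfl, absurd rfl hlm]
            rw [di, dj] at d
            nlinarith
          · obtain rfl : l = i := by
              rcases eq_or_eq_or_eq_fin_three hij hjk hki l with rfl | rfl | rfl
              exacts [rfl, absurd rfl hnl, absurd rfl hlm]
            rw [di, dj] at d
            obtain ⟨e, he⟩ := Nat.exists_eq_add_of_le hji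
            rw [he] at d ⊢
            have := hT2 m
            nlinarith
          · exact absurd rfl hmn
    obtain ⟨⟨hge, hmax⟩, hor⟩ := hcomb
    have hsame : ∀ l, l ≠ n → (T'.mutate n).deg l = T'.deg l := fun l hl => deg_mutate_of_ne hsk hl
    refine ⟨fun l => ?_, fun e => by simp at e, fun m hm => ?_, fun l => ?_⟩
    · by_cases hl : l = n
      · rw [hl]
        exact (ih2 n).trans hge
      · rw [hsame l hl]
        exact ih2 l
    · obtain rfl := Option.some_injective _ hm
      refine ⟨fun l => ?_, hor.imp_right fun e => ⟨e.1, by rw [e.1, e.2]⟩⟩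
      by_cases hl : l = n
      · rw [hl]
      · rw [hsame l hl]
        exact hmax l
    · by_cases hl : l = n
      · subst hl
        rcases hor with hor | ⟨rfl, rfl⟩
        · exact Or.inr (Or.inr hor)
        · exact Or.inl rfl
      · rw [hsame l hl, mutate_x_of_ne _ _ (by simpa using hl)]
        exact ihx l

end Root

end SeedData

/-! ### Explicit formulas for the witness. -/

namespace SeedData

section Formula

variable {n p : ℕ} {F : Type*}

theorem seqCompl_val {a : ℕ} (t : Fin a → Fin 2) (r : Fin a) :
    (seqCompl t r : ℕ) = 1 - (t r : ℕ) := by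
  rw [seqCompl]
  generalize t r = u
  revert u
  decide

variable [Field F]

/-- Grouping the pairs by their mutable column, an entry 0 of the sequence at `l` contributes one
exchange monomial at `l` and an entry 1 the other; frozen columns have exponent 0. -/
theorem xTilde_eq (S : SeedData n p F) (hS : S.SkewSymmetric) (a : Fin n → ℤ) :
    S.xTilde a = (∏ l, S.x (Sum.inl l) ^ (-a l)) * ∑ s ∈ S.gcc a,
      ∏ l, ((∏ i, S.x i ^ (S.B i l).toNat) ^ seqSum (seqCompl (s l)) *
        (∏ i, S.x i ^ (-S.B i l).toNat) ^ seqSum (s l)) := by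
  have hskew : ∀ q r, S.extB q r = -S.extB r q := by
    rintro (q | q) (r | r)
    · exact hS q r
    · rfl
    · simp [extB]
    · rfl
  rw [xTilde]
  congr 1
  refine Finset.sum_congr rfl fun s _ => ?_
  rw [Finset.prod_mul_distrib, Finset.prod_mul_distrib]
  congr 1
  · rw [Finset.prod_filter, Fintype.prod_prod_type_right, Fintype.prod_sum_type]
    rw [Finset.prod_eq_one (s := (Finset.univ : Finset (Fin p)))]
    · rw [mul_one]
      refine Finset.prod_congr rfl fun l _ => ?_
      rw [← Finset.prod_pow]
      refine Finset.prod_congr rfl fun i _ => ?_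
      simp only [Sum.elim_inl]
      split_ifs with h
      · have h' : 0 < S.B i l := by cases i <;> exact h
        have e : S.extB i (Sum.inl l) = ((S.B i l).toNat : ℤ) := by
          rw [Int.toNat_of_nonneg h'.le]
          cases i <;> rfl
        rw [e, ← Nat.cast_mul, zpow_natCast, pow_mul]
      · have h' : S.B i l ≤ 0 := by cases i <;> exact not_lt.1 h
        rw [Int.toNat_of_nonpos h', pow_zero, one_pow]
    · intro l _
      refine Finset.prod_eq_one fun i _ => ?_
      simp
  · rw [Finset.prod_filter, Fintype.prod_prod_type, Fintype.prod_sum_type]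
    rw [Finset.prod_eq_one (s := (Finset.univ : Finset (Fin p)))]
    · rw [mul_one]
      refine Finset.prod_congr rfl fun l _ => ?_
      rw [← Finset.prod_pow]
      refine Finset.prod_congr rfl fun i _ => ?_
      simp only [Sum.elim_inl]
      have e : S.extB i (Sum.inl l) = S.B i l := by cases i <;> rfl
      rw [hskew (Sum.inl l) i, e]
      split_ifs with h
      · rw [show -S.B i l = ((-S.B i l).toNat : ℤ) from (Int.toNat_of_nonneg h.le).symm,
          ← Nat.cast_mul, zpow_natCast, pow_mul, Int.toNat_natCast]
      · rw [Int.toNat_of_nonpos (not_lt.1 h), pow_zero, one_pow]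
    · intro l _
      refine Finset.prod_eq_one fun i _ => ?_
      simp

end Formula

section RankThree

variable {p : ℕ} {F : Type*}

/-- The family of sequences with entries `u` at the index `i` and `v` at all other indices. -/
def pairFamily (α : Fin 3 → ℤ) (i : Fin 3) (u : Fin 2 × Fin 2) : SeqFamily α :=
  fun l _ => if l = i then u.1 else u.2

theorem pairFamily_bijective {α : Fin 3 → ℤ} {i j k : Fin 3} (hij : i ≠ j) (hjk : j ≠ k)
    (hki : k ≠ i) (hi : α i = 1) (hj : α j = 0) (hk : α k = 1) :
    Function.Bijective (pairFamily α i) := by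
  have hi0 : 0 < (α i).toNat := by simp [hi]
  have hk0 : 0 < (α k).toNat := by simp [hk]
  constructor
  · intro u v huv
    have h1 := congrFun (congrFun huv i) ⟨0, hi0⟩
    have h2 := congrFun (congrFun huv k) ⟨0, hk0⟩
    simp only [pairFamily, if_true, if_neg hki] at h1 h2
    exact Prod.ext h1 h2
  · intro s
    refine ⟨(s i ⟨0, hi0⟩, s k ⟨0, hk0⟩), ?_⟩
    funext l r
    have hr := r.2
    rcases eq_or_eq_or_eq_fin_three hij hjk hki l with rfl | rfl | rfl
    · simp only [pairFamily, if_true]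
      congr 1
      ext
      simp only [hi] at hr
      simp at hr ⊢
      omega
    · simp [hj] at hr
    · simp only [pairFamily, if_neg hki]
      congr 1
      ext
      simp only [hk] at hr
      simp at hr ⊢
      omega

theorem seqSum_pairFamily (α : Fin 3 → ℤ) (i l : Fin 3) (u : Fin 2 × Fin 2) :
    seqSum (pairFamily α i u l) = (α l).toNat * ((if l = i then u.1 else u.2 : Fin 2) : ℕ) := by
  simp [seqSum, pairFamily]

theorem seqSum_seqCompl_pairFamily (α : Fin 3 → ℤ) (i l : Fin 3) (u : Fin 2 × Fin 2) :
    seqSum (seqCompl (pairFamily α i u l)) =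
      (α l).toNat * (1 - ((if l = i then u.1 else u.2 : Fin 2) : ℕ)) := by
  simp only [seqSum, seqCompl_val, pairFamily, Finset.sum_const, Finset.card_univ, Fintype.card_fin,
    smul_eq_mul]

theorem seqDot_pairFamily (α : Fin 3 → ℤ) (i l m : Fin 3) (u : Fin 2 × Fin 2) :
    seqDot (pairFamily α i u l) (seqCompl (pairFamily α i u m)) =
      min (α l).toNat (α m).toNat * (((if l = i then u.1 else u.2 : Fin 2) : ℕ) *
        (1 - ((if m = i then u.1 else u.2 : Fin 2) : ℕ))) := by
  simp only [seqDot, seqCompl_val, pairFamily, Finset.sum_const, Finset.card_univ, Fintype.card_fin,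
    smul_eq_mul]

theorem pairFamily_mem_gcc {T : SeedData 3 p F} (hT : T.SkewSymmetric)
    {α : Fin 3 → ℤ} {i j k : Fin 3} (hij : i ≠ j) (hjk : j ≠ k)
    (hki : k ≠ i) (hi : α i = 1) (hj : α j = 0) (hk : α k = 1) (u : Fin 2 × Fin 2) :
    pairFamily α i u ∈ T.gcc α ↔
      ((0 < T.B (Sum.inl i) k → (u.1 : ℕ) * (1 - u.2) = 0) ∧
        (0 < T.B (Sum.inl k) i → (u.2 : ℕ) * (1 - u.1) = 0)) := by
  rw [gcc, Finset.mem_filter]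
  simp only [Finset.mem_univ, true_and, seqDot_pairFamily, principal]
  constructor
  · intro h
    constructor
    · intro h'
      have := h i k h'
      simpa [hi, hk, hki] using this
    · intro h'
      have := h k i h'
      simpa [hi, hk, hki] using this
  · rintro ⟨h1, h2⟩ l m hlm
    have hB := hT.B_self
    rcases eq_or_eq_or_eq_fin_three hij hjk hki l with rfl | rfl | rfl <;>
      rcases eq_or_eq_or_eq_fin_three hij hjk hki m with rfl | rfl | rfl
    all_goals first
      | (rw [hB] at hlm; exact absurd hlm (lt_irrefl _))
      | (simp [hj]; done)
      | simpa [hi, hk, hki] using h1 hlm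
      | simpa [hi, hk, hki] using h2 hlm

variable [Field F]

/-- Of the four products of an exchange monomial at `i` with one at `k`, the compatibility condition
along the arrow between `i` and `k` removes one. By cyclicity it is the product without `x_j`, which
is why a power of `x_j` can be divided out of the witness. -/
theorem xTilde_mul {T : SeedData 3 p F} (hT : T.SkewSymmetric) (hc : T.IsCyclic)
    (hx : ∀ i, T.x i ≠ 0) {i j k : Fin 3} (hij : i ≠ j) (hjk : j ≠ k) (hki : k ≠ i)
    {pi ni pk nk : F} (hpi : pi = ∏ l, T.x l ^ (T.B l i).toNat)
    (hni : ni = ∏ l, T.x l ^ (-T.B l i).toNat) (hpk : pk = ∏ l, T.x l ^ (T.B l k).toNat)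
    (hnk : nk = ∏ l, T.x l ^ (-T.B l k).toNat) :
    T.x (Sum.inl i) * T.x (Sum.inl k) * T.xTilde (Pi.single i 1 + Pi.single k 1) =
      pi * pk + ni * nk + if 0 < T.B (Sum.inl k) i then ni * pk else pi * nk := by
  set α : Fin 3 → ℤ := Pi.single i 1 + Pi.single k 1 with hα
  have hi : α i = 1 := by simp [hα, hki.symm]
  have hj : α j = 0 := by simp [hα, hij.symm, hjk]
  have hk : α k = 1 := by simp [hα, hki]
  rw [xTilde_eq T hT, prod_fin_three hij hjk hki, hi, hj, hk]
  have hxi := hx (Sum.inl i)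
  have hxk := hx (Sum.inl k)
  rw [← mul_assoc]
  have h1 : T.x (Sum.inl i) * T.x (Sum.inl k) * (T.x (Sum.inl i) ^ (-1 : ℤ) *
      (T.x (Sum.inl j) ^ (-0 : ℤ) * T.x (Sum.inl k) ^ (-1 : ℤ))) = 1 := by
    simp only [neg_zero, zpow_zero, zpow_neg_one]
    field_simp
  rw [h1, one_mul]
  have hsum : ∀ f : SeqFamily α → F, ∑ s ∈ T.gcc α, f s =
      ∑ u : Fin 2 × Fin 2, if pairFamily α i u ∈ T.gcc α then f (pairFamily α i u) else 0 := by
    intro f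
    rw [(pairFamily_bijective hij hjk hki hi hj hk).sum_comp
      (fun s => if s ∈ T.gcc α then f s else 0)]
    simp
  rw [hsum, Fintype.sum_prod_type]
  simp only [Fin.sum_univ_two, pairFamily_mem_gcc hT hij hjk hki hi hj hk,
    seqSum_pairFamily, seqSum_seqCompl_pairFamily, prod_fin_three hij hjk hki, hi, hj, hk, ← hpi,
    ← hni, ← hpk, ← hnk, if_neg hki]
  have hcyc := hc i j k hij hjk hki
  have hsw := hT.B_swap i k
  rcases hcyc with h | h
  · have h1 : ¬ 0 < T.B (Sum.inl i) k := by omega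
    simp [h.2.2, h1]
    ring
  · have h1 : 0 < T.B (Sum.inl i) k := by omega
    have h2 : ¬ 0 < T.B (Sum.inl k) i := by omega
    simp [h1, h2]
    ring

/-- A monomial in the frozen variables. -/
def frozenMonomial (T : SeedData 3 p F) (e : Fin p → ℕ) : F :=
  ∏ l, T.x (Sum.inr l) ^ e l

theorem frozenMonomial_mem (T : SeedData 3 p F) (e : Fin p → ℕ) {t : Set (Fin 3 ⊕ Fin p)}
    (ht : ∀ l, Sum.inr l ∈ t) : T.frozenMonomial e ∈ laurentSubring T.x t :=
  Subring.prod_mem _ fun l _ => Subring.pow_mem _ (mem_laurentSubring _ (ht l)) _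

theorem inv_frozenMonomial_mem (T : SeedData 3 p F) (e : Fin p → ℕ) {t : Set (Fin 3 ⊕ Fin p)}
    (ht : ∀ l, Sum.inr l ∈ t) : (T.frozenMonomial e)⁻¹ ∈ laurentSubring T.x t := by
  rw [frozenMonomial, ← Finset.prod_inv_distrib]
  refine Subring.prod_mem _ fun l _ => ?_
  rw [← inv_pow]
  exact Subring.pow_mem _ (inv_mem_laurentSubring _ (ht l)) _

theorem frozenMonomial_ne_zero {T : SeedData 3 p F} (hx : ∀ i, T.x i ≠ 0) (e : Fin p → ℕ) :
    T.frozenMonomial e ≠ 0 :=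
  Finset.prod_ne_zero_iff.2 fun _ _ => pow_ne_zero _ (hx _)

theorem prod_pow_eq_frozenMonomial (T : SeedData 3 p F) {i j k : Fin 3} (hij : i ≠ j) (hjk : j ≠ k)
    (hki : k ≠ i) (e : Fin 3 ⊕ Fin p → ℕ) : ∏ l, T.x l ^ e l =
      T.frozenMonomial (fun l => e (Sum.inr l)) * T.x (Sum.inl i) ^ e (Sum.inl i) *
        T.x (Sum.inl j) ^ e (Sum.inl j) * T.x (Sum.inl k) ^ e (Sum.inl k) := by
  rw [Fintype.prod_sum_type, prod_fin_three hij hjk hki, frozenMonomial]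
  ring

/-- The two exchange relations at the ends of the witness, and the witness in terms of them. -/
theorem exists_witness_eq {T : SeedData 3 p F} (hT : T.SkewSymmetric) (hc : T.IsCyclic)
    (hx : ∀ i, T.x i ≠ 0) {i j k : Fin 3} (hij : i ≠ j) (hjk : j ≠ k) (hki : k ≠ i) :
    ∃ e₁ e₂ e₃ e₄ : Fin p → ℕ,
      T.x (Sum.inl i) * (T.mutate i).x (Sum.inl i) =
        T.frozenMonomial e₁ * T.x (Sum.inl k) ^ T.deg j +
          T.frozenMonomial e₂ * T.x (Sum.inl j) ^ T.deg k ∧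
      T.x (Sum.inl k) * (T.mutate k).x (Sum.inl k) =
        T.frozenMonomial e₃ * T.x (Sum.inl j) ^ T.deg i +
          T.frozenMonomial e₄ * T.x (Sum.inl i) ^ T.deg j ∧
      T.x (Sum.inl i) * T.x (Sum.inl k) * T.xTilde (Pi.single i 1 + Pi.single k 1) =
        T.frozenMonomial e₁ * T.x (Sum.inl k) ^ T.deg j *
            (T.frozenMonomial e₃ * T.x (Sum.inl j) ^ T.deg i) +
          T.frozenMonomial e₂ * T.x (Sum.inl j) ^ T.deg k *
            (T.frozenMonomial e₃ * T.x (Sum.inl j) ^ T.deg i) +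
          T.frozenMonomial e₂ * T.x (Sum.inl j) ^ T.deg k *
            (T.frozenMonomial e₄ * T.x (Sum.inl i) ^ T.deg j) := by
  have hxt := xTilde_mul hT hc hx hij hjk hki rfl rfl rfl rfl
  have hmi : T.x (Sum.inl i) * (T.mutate i).x (Sum.inl i) =
      ∏ l, T.x l ^ (T.B l i).toNat + ∏ l, T.x l ^ (-T.B l i).toNat := by
    rw [mutate_x_self, mul_inv_cancel_left₀ (hx _)]
  have hmk : T.x (Sum.inl k) * (T.mutate k).x (Sum.inl k) =
      ∏ l, T.x l ^ (T.B l k).toNat + ∏ l, T.x l ^ (-T.B l k).toNat := by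
    rw [mutate_x_self, mul_inv_cancel_left₀ (hx _)]
  have d1 := hT.natAbs_eq_deg hij hjk hki
  have d2 := hT.natAbs_eq_deg hjk hki hij
  have d3 := hT.natAbs_eq_deg hki hij hjk
  have s1 := hT.B_swap i j
  have s2 := hT.B_swap j k
  have s3 := hT.B_swap k i
  rw [hxt, hmi, hmk]
  simp only [prod_pow_eq_frozenMonomial T hij hjk hki, hT.B_self]
  rcases hc i j k hij hjk hki with h | h
  · refine ⟨fun l => (T.B (Sum.inr l) i).toNat, fun l => (-T.B (Sum.inr l) i).toNat,
      fun l => (T.B (Sum.inr l) k).toNat, fun l => (-T.B (Sum.inr l) k).toNat, ?_⟩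
    rw [if_pos h.2.2, show (T.B (Sum.inl j) i).toNat = 0 by omega,
      show (T.B (Sum.inl k) i).toNat = T.deg j by omega,
      show (-T.B (Sum.inl j) i).toNat = T.deg k by omega,
      show (-T.B (Sum.inl k) i).toNat = 0 by omega,
      show (T.B (Sum.inl j) k).toNat = T.deg i by omega,
      show (T.B (Sum.inl i) k).toNat = 0 by omega,
      show (-T.B (Sum.inl j) k).toNat = 0 by omega,
      show (-T.B (Sum.inl i) k).toNat = T.deg j by omega]
    simp only [neg_zero, Int.toNat_zero, pow_zero, mul_one]
    exact ⟨trivial, trivial, by ring⟩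
  · refine ⟨fun l => (-T.B (Sum.inr l) i).toNat, fun l => (T.B (Sum.inr l) i).toNat,
      fun l => (-T.B (Sum.inr l) k).toNat, fun l => (T.B (Sum.inr l) k).toNat, ?_⟩
    rw [if_neg (by omega), show (T.B (Sum.inl j) i).toNat = T.deg k by omega,
      show (T.B (Sum.inl k) i).toNat = 0 by omega,
      show (-T.B (Sum.inl j) i).toNat = 0 by omega,
      show (-T.B (Sum.inl k) i).toNat = T.deg j by omega,
      show (T.B (Sum.inl j) k).toNat = 0 by omega,
      show (T.B (Sum.inl i) k).toNat = T.deg j by omega,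
      show (-T.B (Sum.inl j) k).toNat = T.deg i by omega,
      show (-T.B (Sum.inl i) k).toNat = 0 by omega]
    simp only [neg_zero, Int.toNat_zero, pow_zero, mul_one]
    exact ⟨by ring, by ring, by ring⟩

end RankThree

end SeedData

/-! ### The witness lies in the upper bound but not in the cluster algebra. -/

namespace SeedData

theorem MutationEquiv.symm {n p : ℕ} {F : Type*} [Field F] [Algebra ℚ F] {S T : SeedData n p F}
    (h : S.MutationEquiv T) (hx : AlgebraicIndependent ℚ S.x) (hS : S.SkewSymmetric) :
    T.MutationEquiv S := by
  induction h with
  | refl => exact Relation.ReflTransGen.refl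
  | tail hT hm ih =>
    obtain ⟨k, rfl, -⟩ := hm
    have hx' := MutationEquiv.algebraicIndependent hT hS hx
    have hS' := MutationEquiv.skewSymmetric hT hS
    have h1 := (hS'.mutate k).mutates k
    rw [mutate_mutate hx' hS'] at h1
    exact Relation.ReflTransGen.head h1 ih

variable {p : ℕ} {F : Type*} [Field F]

/-- The witness, written without division by `x j`. -/
theorem witness_formulas {T : SeedData 3 p F} (hT : T.SkewSymmetric) (hc : T.IsCyclic)
    (hx : ∀ i, T.x i ≠ 0) {σ : Equiv.Perm (Fin 3)} (hσ : T.IsRoot σ) :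
    ∃ e₁ e₂ e₃ e₄ : Fin p → ℕ,
      T.x (Sum.inl (σ 0)) * (T.mutate (σ 0)).x (Sum.inl (σ 0)) =
        T.frozenMonomial e₁ * T.x (Sum.inl (σ 2)) ^ T.deg (σ 1) +
          T.frozenMonomial e₂ * T.x (Sum.inl (σ 1)) ^ T.deg (σ 2) ∧
      T.x (Sum.inl (σ 2)) * (T.mutate (σ 2)).x (Sum.inl (σ 2)) =
        T.frozenMonomial e₃ * T.x (Sum.inl (σ 1)) ^ T.deg (σ 0) +
          T.frozenMonomial e₄ * T.x (Sum.inl (σ 0)) ^ T.deg (σ 1) ∧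
      T.witness σ * T.x (Sum.inl (σ 2)) =
        T.frozenMonomial e₃ * (T.mutate (σ 0)).x (Sum.inl (σ 0)) +
          T.frozenMonomial e₂ * T.frozenMonomial e₄ *
            T.x (Sum.inl (σ 1)) ^ (T.deg (σ 2) - T.deg (σ 0)) *
            T.x (Sum.inl (σ 0)) ^ (T.deg (σ 1) - 1) ∧
      T.witness σ * T.x (Sum.inl (σ 0)) =
        T.frozenMonomial e₂ * T.x (Sum.inl (σ 1)) ^ (T.deg (σ 2) - T.deg (σ 0)) *
            (T.mutate (σ 2)).x (Sum.inl (σ 2)) +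
          T.frozenMonomial e₁ * T.frozenMonomial e₃ *
            T.x (Sum.inl (σ 2)) ^ (T.deg (σ 1) - 1) := by
  have h01 : σ 0 ≠ σ 1 := σ.injective.ne (by decide)
  have h12 : σ 1 ≠ σ 2 := σ.injective.ne (by decide)
  have h20 : σ 2 ≠ σ 0 := σ.injective.ne (by decide)
  obtain ⟨e₁, e₂, e₃, e₄, hi, hk, hX⟩ := exists_witness_eq hT hc hx h01 h12 h20
  refine ⟨e₁, e₂, e₃, e₄, hi, hk, ?_⟩
  obtain ⟨-, hle, -⟩ := (isRoot_iff hT σ).1 hσ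
  obtain ⟨a, ha⟩ := Nat.exists_eq_add_of_le hle
  obtain ⟨c, hc'⟩ : ∃ c, T.deg (σ 1) = 1 + c :=
    Nat.exists_eq_add_of_le (hc.deg_pos (σ 1))
  have hY : T.witness σ * T.x (Sum.inl (σ 1)) ^ T.deg (σ 0) =
      T.xTilde (Pi.single (σ 0) 1 + Pi.single (σ 2) 1) := by
    rw [witness, Int.abs_eq_natAbs, principal, hT.natAbs_eq_deg h12 h20 h01, zpow_natCast,
      div_mul_cancel₀ _ (pow_ne_zero _ (hx _))]
  rw [← hY] at hX
  have xi0 := hx (Sum.inl (σ 0))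
  have xj0 := hx (Sum.inl (σ 1))
  have xk0 := hx (Sum.inl (σ 2))
  rw [ha, Nat.add_sub_cancel_left, hc', Nat.add_sub_cancel_left]
  rw [ha, hc'] at hX
  rw [ha, hc'] at hi
  rw [hc'] at hk
  generalize T.x (Sum.inl (σ 0)) = xi at *
  generalize T.x (Sum.inl (σ 1)) = xj at *
  generalize T.x (Sum.inl (σ 2)) = xk at *
  generalize T.witness σ = Y at *
  generalize (T.mutate (σ 0)).x (Sum.inl (σ 0)) = xi' at *
  generalize (T.mutate (σ 2)).x (Sum.inl (σ 2)) = xk' at *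
  constructor
  -- Two of the three terms of the expansion combine into a multiple of `x_i x_i'` by the exchange
  -- relation at `i`; symmetrically, the other formula uses the relation at `k`.
  · refine mul_left_cancel₀ (mul_ne_zero xi0 (pow_ne_zero (T.deg (σ 0)) xj0)) ?_
    linear_combination hX - T.frozenMonomial e₃ * xj ^ T.deg (σ 0) * hi
  · refine mul_left_cancel₀ (mul_ne_zero xk0 (pow_ne_zero (T.deg (σ 0)) xj0)) ?_
    linear_combination hX - T.frozenMonomial e₂ * xj ^ T.deg (σ 0) * xj ^ a * hk

/-- The ring `K[x i]` of Laurent polynomials in the extended cluster that are polynomial in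
`x i`. -/
noncomputable def polynomialAt (T : SeedData 3 p F) (i : Fin 3) : Subring F :=
  (Polynomial.aeval (R := T.coefRing i) (T.x (Sum.inl i))).toRingHom.range

theorem coefRing_le_polynomialAt (T : SeedData 3 p F) (i : Fin 3) :
    T.coefRing i ≤ T.polynomialAt i := fun y hy =>
  ⟨Polynomial.C ⟨y, hy⟩, Polynomial.aeval_C _ _⟩

theorem self_mem_polynomialAt (T : SeedData 3 p F) (i : Fin 3) :
    T.x (Sum.inl i) ∈ T.polynomialAt i :=
  ⟨Polynomial.X, Polynomial.aeval_X _⟩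

theorem x_mem_polynomialAt (T : SeedData 3 p F) (i : Fin 3) (l : Fin 3 ⊕ Fin p) :
    T.x l ∈ T.polynomialAt i := by
  by_cases hl : l = Sum.inl i
  · exact hl ▸ T.self_mem_polynomialAt i
  · exact T.coefRing_le_polynomialAt i (mem_laurentSubring _ hl)

theorem IsScaledBy.map_frozenMonomial {T : SeedData 3 p F} {θ : F →+* F} (hθ : T.IsScaledBy θ)
    (e : Fin p → ℕ) : θ (T.frozenMonomial e) = T.frozenMonomial e := by
  rw [frozenMonomial, map_prod]
  refine Finset.prod_congr rfl fun l _ => ?_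
  rw [map_pow, hθ]
  simp

variable [Algebra ℚ F]

theorem witness_mem_upperBound {T : SeedData 3 p F} (hT : T.SkewSymmetric) (hc : T.IsCyclic)
    (hx : AlgebraicIndependent ℚ T.x) {σ : Equiv.Perm (Fin 3)} (hσ : T.IsRoot σ) :
    T.witness σ ∈ T.upperBound := by
  have hx0 : ∀ i, T.x i ≠ 0 := fun i => hx.ne_zero i
  obtain ⟨e₁, e₂, e₃, e₄, hi, -, hY, hY'⟩ := witness_formulas hT hc hx0 hσ
  have h01 : σ 0 ≠ σ 1 := σ.injective.ne (by decide)
  have h12 : σ 1 ≠ σ 2 := σ.injective.ne (by decide)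
  have h20 : σ 2 ≠ σ 0 := σ.injective.ne (by decide)
  rw [← eq_div_iff (hx0 _)] at hY hY'
  -- The witness needs no negative power of `x_j`, which settles both the seed itself and its
  -- mutation at `σ 1`. At `σ 0` and `σ 2` the formulas for `Y x_k` and `Y x_i` avoid the inverse
  -- that is missing there.
  have key : ∀ L : Subring F, (∀ e, T.frozenMonomial e ∈ L) → T.x (Sum.inl (σ 0)) ∈ L →
      (T.x (Sum.inl (σ 0)))⁻¹ ∈ L → T.x (Sum.inl (σ 1)) ∈ L → T.x (Sum.inl (σ 2)) ∈ L →
      (T.x (Sum.inl (σ 2)))⁻¹ ∈ L → T.witness σ ∈ L := by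
    intro L hf h0 h0' h1 h2 h2'
    rw [mul_comm, ← eq_div_iff (hx0 _)] at hi
    rw [hY, hi, div_eq_mul_inv, div_eq_mul_inv]
    refine L.mul_mem (L.add_mem (L.mul_mem (hf _) (L.mul_mem (L.add_mem ?_ ?_) h0'))
      (L.mul_mem (L.mul_mem (L.mul_mem (hf _) (hf _)) (L.pow_mem h1 _)) (L.pow_mem h0 _))) h2'
    · exact L.mul_mem (hf _) (L.pow_mem h2 _)
    · exact L.mul_mem (hf _) (L.pow_mem h1 _)
  have hfr : ∀ m e, T.frozenMonomial e ∈ laurentSubring (T.mutate m).x Set.univ := by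
    intro m e
    have : T.frozenMonomial e = (T.mutate m).frozenMonomial e :=
      Finset.prod_congr rfl fun l _ => by rw [mutate_x_inr]
    rw [this]
    exact frozenMonomial_mem _ _ fun _ => Set.mem_univ _
  have hmem : ∀ m l, T.x (Sum.inl l) ∈ laurentSubring (T.mutate m).x Set.univ := by
    intro m l
    by_cases hl : l = m
    · subst hl
      exact exchangeRing_le_laurentSubring_mutate hx hT l (self_mem_exchangeRing _ _ _)
    · rw [← mutate_x_of_ne T m (show Sum.inl l ≠ Sum.inl m by simpa using hl)]
      exact mem_laurentSubring _ (Set.mem_univ _)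
  have hinv : ∀ m l, l ≠ m →
      (T.x (Sum.inl l))⁻¹ ∈ laurentSubring (T.mutate m).x Set.univ := by
    intro m l hl
    rw [← mutate_x_of_ne T m (show Sum.inl l ≠ Sum.inl m by simpa using hl)]
    exact inv_mem_laurentSubring _ (Set.mem_univ _)
  rw [mem_upperBound]
  refine ⟨key _ (fun e => frozenMonomial_mem _ _ fun _ => Set.mem_univ _)
    (mem_laurentSubring _ (Set.mem_univ _)) (inv_mem_laurentSubring _ (Set.mem_univ _))
    (mem_laurentSubring _ (Set.mem_univ _)) (mem_laurentSubring _ (Set.mem_univ _))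
    (inv_mem_laurentSubring _ (Set.mem_univ _)), fun m => ?_⟩
  rcases eq_or_eq_or_eq_fin_three h01 h12 h20 m with rfl | rfl | rfl
  · rw [hY, div_eq_mul_inv]
    refine Subring.mul_mem _ (Subring.add_mem _ (Subring.mul_mem _ (hfr _ _)
      (mem_laurentSubring _ (Set.mem_univ _))) (Subring.mul_mem _ (Subring.mul_mem _
      (Subring.mul_mem _ (hfr _ _) (hfr _ _)) (Subring.pow_mem _ (hmem _ _) _))
      (Subring.pow_mem _ (hmem _ _) _))) (hinv _ _ h20)
  · exact key _ (hfr _) (hmem _ _) (hinv _ _ h01) (hmem _ _) (hmem _ _) (hinv _ _ h12.symm)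
  · rw [hY', div_eq_mul_inv]
    refine Subring.mul_mem _ (Subring.add_mem _ (Subring.mul_mem _ (Subring.mul_mem _ (hfr _ _)
      (Subring.pow_mem _ (hmem _ _) _)) (mem_laurentSubring _ (Set.mem_univ _)))
      (Subring.mul_mem _ (Subring.mul_mem _ (hfr _ _) (hfr _ _))
      (Subring.pow_mem _ (hmem _ _) _))) (hinv _ _ h20.symm)

/-- If `x_i' = q(x_i)`, then `X * q` would equal a nonzero constant of the coefficient ring; its
constant term is 0. -/
theorem mutate_x_notMem_polynomialAt {T : SeedData 3 p F} (hT : T.SkewSymmetric)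
    (hx : AlgebraicIndependent ℚ T.x) (i : Fin 3) :
    (T.mutate i).x (Sum.inl i) ∉ T.polynomialAt i := by
  rintro ⟨q, hq⟩
  change Polynomial.aeval _ q = _ at hq
  have hmem : ∀ e : Fin 3 ⊕ Fin p → ℕ, e (Sum.inl i) = 0 → ∏ l, T.x l ^ e l ∈ T.coefRing i :=
    fun e he => (prod_pow_mem fun l hl => by
      rw [Set.notMem_compl_iff, Set.mem_singleton_iff] at hl
      rw [hl, he]).1
  have hs := Subring.add_mem _ (hmem (fun l => (T.B l i).toNat) (by simp [hT.B_self]))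
    (hmem (fun l => (-T.B l i).toNat) (by simp [hT.B_self]))
  have heq : Polynomial.X * q = Polynomial.C (⟨_, hs⟩ : T.coefRing i) := by
    refine transcendental_iff_injective.1 (transcendental_coefRing hx i) ?_
    rw [map_mul, Polynomial.aeval_X, hq, Polynomial.aeval_C, mutate_x_self,
      mul_inv_cancel_left₀ (hx.ne_zero _)]
    rfl
  have h0 := congrArg (fun r => Polynomial.coeff r 0) heq
  simp only [Polynomial.mul_coeff_zero, Polynomial.coeff_X_zero, zero_mul,
    Polynomial.coeff_C_zero] at h0
  exact prod_pow_add_prod_pow_ne_zero hx _ _ (congrArg Subtype.val h0).symm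

theorem map_witness {T : SeedData 3 p F} (hT : T.SkewSymmetric)
    (hc : ∀ T', T.MutationEquiv T' → T'.IsCyclic) (hx : AlgebraicIndependent ℚ T.x)
    {σ : Equiv.Perm (Fin 3)} (hσ : T.IsRoot σ) {θ : F →+* F} (hθ : T.IsScaledBy θ) {d : ℕ}
    (hd : d + T.deg (σ 2) + T.deg (σ 0) = T.deg (σ 2) * T.deg (σ 1)) :
    θ (T.witness σ) = 2 ^ d * T.witness σ := by
  have : CharZero F := algebraRat.charZero F
  have hrefl : T.MutationEquiv T := Relation.ReflTransGen.refl
  have hx0 : ∀ i, T.x i ≠ 0 := fun i => hx.ne_zero i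
  obtain ⟨e₁, e₂, e₃, e₄, -, -, hY, -⟩ := witness_formulas hT (hc T hrefl) hx0 hσ
  have h01 : σ 0 ≠ σ 1 := σ.injective.ne (by decide)
  have h12 : σ 1 ≠ σ 2 := σ.injective.ne (by decide)
  have h20 : σ 2 ≠ σ 0 := σ.injective.ne (by decide)
  have hc' := hc _ (hrefl.mutate hT (σ 0))
  have hθ' := hθ.mutate hx hT (hc T hrefl) hc' (Sum.inl (σ 0))
  have hdeg := deg_mutate_self hT (hc T hrefl) h12 h20 h01 hc'
  have hj := (hc T hrefl).deg_pos (σ 1)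
  obtain ⟨-, hle, -⟩ := (isRoot_iff hT σ).1 hσ
  have hD : (T.mutate (σ 0)).deg (σ 0) = d + T.deg (σ 2) := by
    rw [mul_comm] at hd
    omega
  -- The second summand of `Y x_k` has the same degree as `x_i'`, so `Y` is homogeneous.
  have hE : T.deg (σ 1) * (T.deg (σ 2) - T.deg (σ 0)) + T.deg (σ 0) * (T.deg (σ 1) - 1) =
      d + T.deg (σ 2) := by
    obtain ⟨a, ha⟩ := Nat.exists_eq_add_of_le hle
    obtain ⟨c, hc⟩ := Nat.exists_eq_add_of_le hj
    rw [ha, Nat.add_sub_cancel_left, hc, Nat.add_sub_cancel_left]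
    rw [ha, hc] at hd
    linarith
  have hi := hθ (Sum.inl (σ 0))
  have hj := hθ (Sum.inl (σ 1))
  have hk := hθ (Sum.inl (σ 2))
  simp only [Sum.elim_inl] at hi hj hk hθ'
  rw [hD] at hθ'
  have h := congrArg θ hY
  simp only [map_mul, map_add, map_pow, hθ.map_frozenMonomial, hi, hj, hk, hθ', mul_pow,
    ← pow_mul] at h
  have h2 : (2 : F) ≠ 0 := two_ne_zero
  refine mul_right_cancel₀ (mul_ne_zero (pow_ne_zero (T.deg (σ 2)) h2) (hx0 (Sum.inl (σ 2)))) ?_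
  rw [h]
  have hE' : (2 : F) ^ (T.deg (σ 1) * (T.deg (σ 2) - T.deg (σ 0))) *
      2 ^ (T.deg (σ 0) * (T.deg (σ 1) - 1)) = 2 ^ d * 2 ^ T.deg (σ 2) := by
    rw [← pow_add, hE, pow_add]
  rw [pow_add]
  linear_combination (T.frozenMonomial e₂ * T.frozenMonomial e₄ *
    T.x (Sum.inl (σ 1)) ^ (T.deg (σ 2) - T.deg (σ 0)) * T.x (Sum.inl (σ 0)) ^ (T.deg (σ 1) - 1)) *
      hE' - 2 ^ d * 2 ^ T.deg (σ 2) * hY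

theorem witness_notMem_clusterAlgebra {S T : SeedData 3 p F} (hST : S.MutationEquiv T)
    (hS : S.SkewSymmetric) (hc : ∀ T, S.MutationEquiv T → T.IsCyclic)
    (hx : AlgebraicIndependent ℚ S.x) (htop : IntermediateField.adjoin ℚ (Set.range S.x) = ⊤)
    {σ : Equiv.Perm (Fin 3)} (hσ : T.IsRoot σ) : T.witness σ ∉ S.clusterAlgebra := by
  intro hmem
  have hT := hST.skewSymmetric hS
  have hxT := hST.algebraicIndependent hS hx
  have hTc : ∀ T', T.MutationEquiv T' → T'.IsCyclic := fun T' h => hc T' (hST.trans h)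
  have hTcyc := hc T hST
  have hx0 : ∀ i, T.x i ≠ 0 := fun i => hxT.ne_zero i
  obtain ⟨θ, hθ⟩ := exists_scaling hx htop (Sum.elim S.deg (0 : Fin p → ℕ))
  replace hθ : ∀ T, S.MutationEquiv T → T.IsScaledBy θ := fun T h => h.isScaledBy hx hS hc hθ
  have hθT := hθ T hST
  have h01 : σ 0 ≠ σ 1 := σ.injective.ne (by decide)
  have h12 : σ 1 ≠ σ 2 := σ.injective.ne (by decide)
  have h20 : σ 2 ≠ σ 0 := σ.injective.ne (by decide)
  obtain ⟨r1, r2, r3, -⟩ := (isRoot_iff hT σ).1 hσ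
  have hge : T.deg (σ 2) + T.deg (σ 0) ≤ T.deg (σ 2) * T.deg (σ 1) := by
    have := two_le_deg_of_root hTc h01 h12 h20 r1 r2 r3 (σ 1)
    nlinarith
  obtain ⟨d, hd⟩ := Nat.exists_eq_add_of_le hge
  have hd' : d + T.deg (σ 2) + T.deg (σ 0) = T.deg (σ 2) * T.deg (σ 1) := by omega
  obtain ⟨e₁, e₂, e₃, e₄, -, hk, hY, -⟩ := witness_formulas hT hTcyc hx0 hσ
  set V := T.polynomialAt (σ 0) with hV
  have hfrozen : ∀ l, (Sum.inr l : Fin 3 ⊕ Fin p) ∈ ({Sum.inl (σ 0)}ᶜ : Set (Fin 3 ⊕ Fin p)) := by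
    simp
  have hfV : ∀ e, T.frozenMonomial e ∈ V := fun e =>
    T.coefRing_le_polynomialAt _ (frozenMonomial_mem _ _ hfrozen)
  have hxV : ∀ l, T.x l ∈ V := T.x_mem_polynomialAt (σ 0)
  -- Homogeneity reduces this to the generators of degree at most `d`: the ground ring in degree 0,
  -- the cluster of `T`, and `x_k'`, whose only non-frozen denominator is `x_k`. All other cluster
  -- variables have degree at least `d + deg (σ 2)`, hence more than `d`.
  have hYV : T.witness σ ∈ V := by
    refine mem_of_mem_closure_of_eigenvector (d := d) ?_ hmem (map_witness hT hTc hxT hσ hθT hd')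
    rintro g (hg | ⟨T', hT', l, rfl⟩)
    · refine ⟨0, ?_, fun _ => T.coefRing_le_polynomialAt _ ?_⟩
      · have hle : S.groundRing ≤ θ.eqLocus (RingHom.id F) := by
          have hl : ∀ l, θ (S.x (Sum.inr l)) = S.x (Sum.inr l) := fun l => by
            rw [hθ S Relation.ReflTransGen.refl]
            simp
          refine Subring.closure_le.2 ?_
          rintro y ⟨l, rfl | rfl⟩
          · exact hl l
          · change θ _ = _
            rw [map_inv₀, hl]
            rfl
        rw [pow_zero, one_mul]
        exact hle hg
      · have hle : S.groundRing ≤ T.coefRing (σ 0) := by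
          refine Subring.closure_le.2 ?_
          rintro y ⟨l, rfl | rfl⟩ <;> rw [← hST.x_inr]
          exacts [mem_laurentSubring _ (hfrozen l), inv_mem_laurentSubring _ (hfrozen l)]
        exact hle hg
    · refine ⟨T'.deg l, hθ T' hT' (Sum.inl l), fun hle => ?_⟩
      have hTT' : T.MutationEquiv T' := (hST.symm hx hS).trans hT'
      obtain ⟨o, ho⟩ := hTT'.exists_reducedFrom hxT hT
      rcases (ho.deg_le hTc h01 h12 h20 r1 r2 r3 hT).2.2.2 l with h | h | h
      · rw [h]
        rw [mul_comm, ← eq_div_iff (hx0 _)] at hk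
        rw [hk, div_eq_mul_inv]
        refine V.mul_mem (V.add_mem (V.mul_mem (hfV _) (V.pow_mem (hxV _) _))
          (V.mul_mem (hfV _) (V.pow_mem (hxV _) _))) (T.coefRing_le_polynomialAt _ ?_)
        exact inv_mem_laurentSubring _ (by simp [h20])
      · rw [h]
        exact hxV _
      · have := hTcyc.deg_pos (σ 2)
        omega
  refine mutate_x_notMem_polynomialAt hT hxT (σ 0) ?_
  have he := frozenMonomial_ne_zero hx0 e₃
  have : (T.mutate (σ 0)).x (Sum.inl (σ 0)) = (T.frozenMonomial e₃)⁻¹ *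
      (T.witness σ * T.x (Sum.inl (σ 2)) - T.frozenMonomial e₂ * T.frozenMonomial e₄ *
        T.x (Sum.inl (σ 1)) ^ (T.deg (σ 2) - T.deg (σ 0)) *
        T.x (Sum.inl (σ 0)) ^ (T.deg (σ 1) - 1)) := by
    rw [hY, add_sub_cancel_right, inv_mul_cancel_left₀ he]
  rw [this]
  exact V.mul_mem (T.coefRing_le_polynomialAt _ (inv_frozenMonomial_mem _ _ hfrozen))
    (V.sub_mem (V.mul_mem hYV (hxV _)) (V.mul_mem (V.mul_mem (V.mul_mem (hfV _) (hfV _))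
      (V.pow_mem (hxV _) _)) (V.pow_mem (hxV _) _)))

end SeedData

end GeomCluster

theorem theorem1p3 (p : ℕ)
    (S : GeomCluster.SeedData 3 p (FractionRing (MvPolynomial (Fin 3 ⊕ Fin p) ℚ)))
    (hS : S.IsSeed) (hskew : S.SkewSymmetric) (hna : S.NonAcyclic) :
    S.clusterAlgebra < S.upperClusterAlgebra ∧
      (∃ T σ, S.MutationEquiv T ∧ T.IsRoot σ) ∧
      ∀ T σ, S.MutationEquiv T → T.IsRoot σ →
        T.witness σ ∈ S.upperClusterAlgebra ∧ T.witness σ ∉ S.clusterAlgebra := by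
  obtain ⟨hx, htop, -⟩ := hS
  have hc : ∀ T, S.MutationEquiv T → T.IsCyclic := fun T hT =>
    (hT.skewSymmetric hskew).isCyclic (hna T hT)
  have h0 : ∀ T, S.MutationEquiv T → ∀ j k, j ≠ k → T.B (Sum.inl j) k ≠ 0 :=
    fun T hT j k hjk => (hc T hT).B_ne_zero hjk
  have hroot := GeomCluster.SeedData.exists_isRoot hskew hc
  have hwit : ∀ T σ, S.MutationEquiv T → T.IsRoot σ →
      T.witness σ ∈ S.upperClusterAlgebra ∧ T.witness σ ∉ S.clusterAlgebra := by
    intro T σ hT hσ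
    refine ⟨GeomCluster.SeedData.upperBound_le_upperClusterAlgebra hx hskew h0 ?_,
      GeomCluster.SeedData.witness_notMem_clusterAlgebra hT hskew hc hx htop hσ⟩
    rw [← hT.upperBound_eq hx hskew h0]
    exact GeomCluster.SeedData.witness_mem_upperBound (hT.skewSymmetric hskew) (hc T hT)
      (hT.algebraicIndependent hskew hx) hσ
  refine ⟨lt_of_le_of_ne ?_ fun heq => ?_, hroot, hwit⟩
  · exact (GeomCluster.SeedData.clusterAlgebra_le_upperBound hx hskew h0).trans
      (GeomCluster.SeedData.upperBound_le_upperClusterAlgebra hx hskew h0)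
  · obtain ⟨T, σ, hT, hσ⟩ := hroot
    have h := hwit T σ hT hσ
    exact h.2 (heq ▸ h.1)
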